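/- **Setting.** Let $\Lambda=\mathbb T^3$. A density matrix of order $k\ge 1$ is a function $\sigma^{(k)}\in L^2(\Lambda^k\times\Lambda^k)$ (with normalized Haar measure), with Fourier coefficients $$\widehat\sigma^{(k)}(\vec\xi_k;\vec\xi_k')=\int \sigma^{(k)}(\vec x_k;\vec x_k')\,e^{-i\sum_j\langle x_j,\xi_j\rangle+i\sum_j\langle x_j',\xi_j'\rangle}\,d\vec x_k\,d\vec x_k',\qquad \vec\xi_k,\vec\xi'_k\in(\mathbb Z^3)^k .$$ With $\langle\zeta\rangle=\sqrt{1+|\zeta|^2}$ put $$\|\sigma^{(k)}\|_{H^\alpha}=\Big(\sum_{\vec\xi_k,\vec\xi'_k}\prod_{j}\langle\xi_j\rangle^{2\alpha}\langle\xi_j'\rangle^{2\alpha}\,|\widehat\sigma^{(k)}(\vec\xi_k;\vec\xi'_k)|^2\Big)^{1/2}.$$ The free evolution is $\mathcal U^{(k)}(t)\sigma^{(k)}=e^{it\sum_j\Delta_{x_j}}\sigma^{(k)}e^{-it\sum_j\Delta_{x'_j}}$, i.e. multiplication of $\widehat\sigma^{(k)}$ by $e^{-it\sum_j(|\xi_j|^2-|\xi'_j|^2)}$.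 Let $(h_\zeta)_{\zeta\in\mathbb Z^3}$ be independent random variables on a probability space $(\Omega,p)$, each equal to $\pm1$ with probability $\tfrac12$, and let $\Omega^*=\prod_{\ell\ge2}\Omega$ with the product measure $p^*$ and elements $\omega^*=(\omega_2,\omega_3,\dots)$. For $\sigma\in L^2(\Omega^*;L^2(\Lambda^{k+1}\times\Lambda^{k+1}))$ and $1\le j\le k$, the randomized collision operators are given by the Fourier coefficients $$\big([B^+_{j,k+1}]^{\omega_{k+1}}\sigma\big)^\wedge(\vec\xi_k;\vec\xi_k')=\sum_{a,b\in\mathbb Z^3}h_{\xi_j}h_{\xi_j-a+b}h_ah_b\;\widehat\sigma(\xi_1,\dots,\xi_j-a+b,\dots,\xi_k,a;\xi_1',\dots,\xi_k',b),$$ $$\big([B^-_{j,k+1}]^{\omega_{k+1}}\sigma\big)^\wedge(\vec\xi_k;\vec\xi_k')=\sum_{a,b\in\mathbb Z^3}h_{\xi'_j}h_{\xi'_j-b+a}h_ah_b\;\widehat\sigma(\xi_1,\dots,\xi_k,a;\xi_1',\dots,\xi'_j-b+a,\dots,\xi_k',b),$$ where all $h$'s are evaluated at $\omega_{k+1}$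 and the sums are unconditional sums in $L^2(\Omega^*)$; $\sigma$ is in the domain if these sums exist and are the Fourier coefficients of an element of $L^2(\Omega^*;L^2(\Lambda^k\times\Lambda^k))$. Put $[B^{(k+1)}]^{\omega_{k+1}}=\sum_{j=1}^k\big([B^+_{j,k+1}]^{\omega_{k+1}}-[B^-_{j,k+1}]^{\omega_{k+1}}\big)$. For sequences $\Sigma=(\sigma^{(k)})_{k\ge1}$ put $([\widehat B]^{\omega^*}\Sigma)^{(k)}=[B^{(k+1)}]^{\omega_{k+1}}\sigma^{(k+1)}$, $(\mathcal U(t)\Sigma)^{(k)}=\mathcal U^{(k)}(t)\sigma^{(k)}$, and $$\|\Sigma\|_{\mathcal H^\alpha_\xi}=\sum_{k\ge1}\xi^k\|\sigma^{(k)}\|_{H^\alpha},\qquad \|\Sigma\|_{L^\infty_{t\in I}L^2(\Omega^*)\mathcal H^\alpha_\xi}=\operatorname*{ess\,sup}_{t\in I}\sum_{k\ge1}\xi^k\,\|\sigma^{(k)}(t)\|_{L^2(\Omega^*)H^\alpha},$$ for deterministic sequences and for sequences depending on $(t,\omega^*)$, respectively. For deterministic $\Gamma(0)=(\gamma_0^{(k)})_{k\ge1}$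 let $$Duh_j^{\omega^*}(\Gamma(0))^{(k)}(t)=(-i)^j\int_0^t\!\int_0^{t_1}\!\!\cdots\int_0^{t_{j-1}}\mathcal U^{(k)}(t-t_1)[B^{(k+1)}]^{\omega_{k+1}}\mathcal U^{(k+1)}(t_1-t_2)\cdots[B^{(k+j)}]^{\omega_{k+j}}\mathcal U^{(k+j)}(t_j)\gamma_0^{(k+j)}\,dt_j\cdots dt_1$$ (for $j=0$: $\mathcal U^{(k)}(t)\gamma_0^{(k)}$), and let $[\Gamma_N]^{\omega^*}$ be the solution of the truncated hierarchy given by $([\Gamma_N]^{\omega^*})^{(k)}(t)=\sum_{j=0}^{N-k}Duh_j^{\omega^*}(\Gamma(0))^{(k)}(t)$ for $k\le N$ and $0$ for $k>N$. **Theorem.** There is a universal constant $C_2>0$, and for every $\alpha>\frac34$ a constant $C_1>0$ depending only on $\alpha$, such that the following holds. Let $0<\xi<\xi'$ with $\frac{C_2\xi}{\xi'}<1$, let $T>0$ with $\frac{C_1T}{\xi'}<1$, let $I=[0,T]$, and let $\Gamma(0)\in\mathcal H^\alpha_{\xi'}$. Then there is $[\Gamma]^{\omega^*}\in L^\infty_{t\in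 I}L^2(\Omega^*)\mathcal H^\alpha_\xi$ such that: 1. $[\Gamma_N]^{\omega^*}\to[\Gamma]^{\omega^*}$ in $L^\infty_{t\in I}L^2(\Omega^*)\mathcal H^\alpha_\xi$ as $N\to\infty$. 2. For almost every $s\in I$ and all $k\ge 1$, $([\Gamma]^{\omega^*})^{(k+1)}(s)$ lies in the domain of all $[B^{\pm}_{j,k+1}]^{\omega_{k+1}}$, $1\le j\le k$; the integrals below exist as Bochner integrals in $L^2(\Omega^*;L^2(\Lambda^k\times\Lambda^k))$; and for every $\xi_0>0$ $$\Big\|[\Gamma]^{\omega^*}(t)-\mathcal U(t)\Gamma(0)+i\int_0^t\mathcal U(t-s)[\widehat B]^{\omega^*}[\Gamma]^{\omega^*}(s)\,ds\Big\|_{L^\infty_{t\in I}L^2(\Omega^*)\mathcal H^\alpha_{\xi_0}}=0 .$$ 3. In particular, for almost every $t\in I$ and all $k\ge1$, $$\Big\|\Big([\Gamma]^{\omega^*}(t)-\mathcal U(t)\Gamma(0)+i\int_0^t\mathcal U(t-s)[\widehat B]^{\omega^*}[\Gamma]^{\omega^*}(s)\,ds\Big)^{(k)}\Big\|_{L^2(\Omega^*)H^\alpha(\Lambda^k\times\Lambda^k)}=0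 .$$ 4. $\|[\Gamma]^{\omega^*}\|_{L^\infty_{t\in I}L^2(\Omega^*)\mathcal H^\alpha_\xi}\le C\,\|\Gamma(0)\|_{\mathcal H^\alpha_{\xi'}}$ with a constant $C$ depending only on $\xi,\xi',\alpha$. -/

import Mathlib

open MeasureTheory Filter Topology
open scoped ENNReal

noncomputable section

namespace GPHierarchy

universe u

/-! ### Density matrices, Fourier coefficients, Sobolev norms, free evolution -/

/-- The frequency lattice `ℤ³` of the torus `𝕋³`. -/
abbrev Freq : Type := Fin 3 → ℤ

/-- The coordinates of `Λᵏ × Λᵏ`, where `Λ = 𝕋³`: `Sum.inl (j, i)` is the `i`-th coordinate of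
the position `x_j`, and `Sum.inr (j, i)` is the `i`-th coordinate of the position `x'_j`. -/
abbrev Coord (k : ℕ) : Type := (Fin k × Fin 3) ⊕ (Fin k × Fin 3)

/-- The space `Λᵏ × Λᵏ`. A point `x` of `ℝ / 2πℤ` is written `x = 2π y` with `y` in `ℝ / ℤ`, so
that `exp (i n x) = exp (2π i n y)`. -/
abbrev Domain (k : ℕ) : Type := UnitAddTorus (Coord k)

/-- The Haar probability measure on `Λᵏ × Λᵏ`. -/
abbrev domainMeasure (k : ℕ) : Measure (Domain k) := Measure.pi fun _ => AddCircle.haarAddCircle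

/-- The space `L²(Λᵏ × Λᵏ)` of square integrable density matrices of order `k`. -/
abbrev DensityMatrix (k : ℕ) : Type := Lp ℂ 2 (domainMeasure k)

/-- The character with frequencies `(ξ; ξ')`, in the convention of density matrices, is
`exp (i ∑ ⟨x_j, ξ_j⟩ - i ∑ ⟨x'_j, ξ'_j⟩)`. -/
def freqVec {k : ℕ} (ξ ξ' : Fin k → Freq) : Coord k → ℤ :=
  Sum.elim (fun q => ξ q.1 q.2) (fun q => - ξ' q.1 q.2)

/-- The Fourier coefficient
`σ̂ (ξ; ξ') = ∫ σ (x; x') exp (-i ∑ ⟨x_j, ξ_j⟩ + i ∑ ⟨x'_j, ξ'_j⟩) dx dx'`. -/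
def fourierCoeff {k : ℕ} (σ : DensityMatrix k) (ξ ξ' : Fin k → Freq) : ℂ :=
  ∫ x, UnitAddTorus.mFourier (-freqVec ξ ξ') x * σ x ∂(domainMeasure k)

/-- The Hilbert basis of `L²(Λᵏ × Λᵏ)` that consists of the characters. -/
def characterBasis (k : ℕ) : HilbertBasis (Coord k → ℤ) ℂ (DensityMatrix k) :=
  UnitAddTorus.mFourierBasis (d := Coord k)

theorem characterBasis_repr {k : ℕ} (σ : DensityMatrix k) (ξ ξ' : Fin k → Freq) :
    (characterBasis k).repr σ (freqVec ξ ξ') = fourierCoeff σ ξ ξ' :=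
  UnitAddTorus.mFourierBasis_repr (d := Coord k) σ (freqVec ξ ξ')

/-- The Japanese bracket `⟨ζ⟩ = √(1 + |ζ|²)` of a frequency. -/
def japaneseBracket (ζ : Freq) : ℝ := Real.sqrt (1 + ∑ i, (ζ i : ℝ) ^ 2)

/-- The symbol `⟨ξ₁⟩^α ⋯ ⟨ξ_k⟩^α ⟨ξ'₁⟩^α ⋯ ⟨ξ'_k⟩^α` of the operator `S^(k,α)`. -/
def sobolevWeight {k : ℕ} (α : ℝ) (ξ ξ' : Fin k → Freq) : ℝ :=
  (∏ j, japaneseBracket (ξ j) ^ α) * ∏ j, japaneseBracket (ξ' j) ^ α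

/-- The norm `‖S^(k,α) σ‖` of `L²(Λᵏ × Λᵏ)`, that is, the norm of `H^α(Λᵏ × Λᵏ)`, with value `∞`
if `σ` does not belong to this space. -/
def sobolevNorm {k : ℕ} (α : ℝ) (σ : DensityMatrix k) : ℝ≥0∞ :=
  (∑' q : (Fin k → Freq) × (Fin k → Freq),
    ‖(sobolevWeight α q.1 q.2 : ℂ) * fourierCoeff σ q.1 q.2‖ₑ ^ 2) ^ (1 / 2 : ℝ)

/-- Multiplication of square summable families by a family of complex numbers of modulus one. -/
def unimodularMul {ι : Type} (c : ι → ℂ) (hc : ∀ i, ‖c i‖ = 1) :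
    lp (fun _ : ι => ℂ) 2 →ₗᵢ[ℂ] lp (fun _ : ι => ℂ) 2 where
  toFun f := ⟨fun i => c i * f i, by
    have hf := lp.memℓp f
    refine (memℓp_gen_iff (by norm_num)).2 ?_
    have := (memℓp_gen_iff (p := 2) (by norm_num)).1 hf
    simpa [norm_mul, hc] using this⟩
  map_add' f g := by ext i; exact mul_add _ _ _
  map_smul' a f := by ext i; simp [mul_left_comm]
  norm_map' f := by
    rw [lp.norm_eq_tsum_rpow (by norm_num), lp.norm_eq_tsum_rpow (by norm_num)]
    simp [hc]

/-- The symbol `exp (-i t (∑ |ξ_j|² - ∑ |ξ'_j|²))` of the free evolution, as a function of the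
character of `Λᵏ × Λᵏ` on which it acts. -/
def freeSymbol (k : ℕ) (t : ℝ) (n : Coord k → ℤ) : ℂ :=
  Complex.exp (((-t * (∑ q : Fin k × Fin 3, (n (Sum.inl q) : ℝ) ^ 2
    - ∑ q : Fin k × Fin 3, (n (Sum.inr q) : ℝ) ^ 2) : ℝ) : ℂ) * Complex.I)

theorem norm_freeSymbol (k : ℕ) (t : ℝ) (n : Coord k → ℤ) : ‖freeSymbol k t n‖ = 1 :=
  Complex.norm_exp_ofReal_mul_I _

/-- The free evolution `U^(k)(t) σ = e^{it ∑ Δ_{x_j}} σ e^{-it ∑ Δ_{x'_j}}`. -/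
def freeEvolution (k : ℕ) (t : ℝ) : DensityMatrix k →L[ℂ] DensityMatrix k :=
  ((characterBasis k).repr.symm.toLinearIsometry.comp
    ((unimodularMul (freeSymbol k t) (norm_freeSymbol k t)).comp
      (characterBasis k).repr.toLinearIsometry)).toContinuousLinearMap

/-- On the Fourier side, the free evolution is the multiplication by its symbol. -/
theorem fourierCoeff_freeEvolution {k : ℕ} (t : ℝ) (σ : DensityMatrix k) (ξ ξ' : Fin k → Freq) :
    fourierCoeff (freeEvolution k t σ) ξ ξ' =
      freeSymbol k t (freqVec ξ ξ') * fourierCoeff σ ξ ξ' := by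
  rw [← characterBasis_repr, ← characterBasis_repr]
  simp [freeEvolution, unimodularMul]

/-! ### The probability space -/

/-- `(h_ζ)` is a family of independent random variables on `(Ω, p)`, each of them equal to `1` or
to `-1` with probability `1/2`. -/
structure IsBernoulliFamily {Ω : Type u} [MeasurableSpace Ω] (p : Measure Ω)
    (h : Freq → Ω → ℝ) : Prop where
  measurable : ∀ ζ, Measurable (h ζ)
  indep : ProbabilityTheory.iIndepFun h p
  prob_one : ∀ ζ, p {ω | h ζ ω = 1} = 1 / 2
  prob_neg_one : ∀ ζ, p {ω | h ζ ω = -1} = 1 / 2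

/-- The product `Ω* = ∏_{ℓ ≥ 2} Ω`, with elements `ω* = (ω₂, ω₃, ω₄, …)`. -/
abbrev OmegaStar (Ω : Type u) : Type u := {ℓ : ℕ // 2 ≤ ℓ} → Ω

section Random

variable {Ω : Type u} [MeasurableSpace Ω] (p : Measure Ω) [IsProbabilityMeasure p]

/-- The product probability measure `p*` on `Ω*`. -/
abbrev starMeasure : Measure (OmegaStar Ω) := Measure.infinitePi (fun _ => p)

/-- Density matrices of order `k` that depend on `ω*`: the space `L²(Ω*; L²(Λᵏ × Λᵏ))`. -/
abbrev RandomDM (k : ℕ) : Type u := Lp (DensityMatrix k) 2 (starMeasure p)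

/-- A deterministic density matrix, as a random one. -/
def constRandom {k : ℕ} (σ : DensityMatrix k) : RandomDM p k := Lp.const 2 (starMeasure p) σ

variable {p}

/-- The free evolution of a random density matrix, for each value of `ω*`. -/
def freeEvolutionR (k : ℕ) (t : ℝ) (σ : RandomDM p k) : RandomDM p k :=
  (freeEvolution k t).compLp σ

/-- The norm of `L²(Ω*) H^α(Λᵏ × Λᵏ)`. -/
def randomSobolevNorm {k : ℕ} (α : ℝ) (σ : RandomDM p k) : ℝ≥0∞ :=
  (∫⁻ ω, sobolevNorm α (σ ω) ^ 2 ∂(starMeasure p)) ^ (1 / 2 : ℝ)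

/-! ### The randomized collision operators -/

/-- The index of the random parameter `ω_{k+1}` on which the operators `B_{j,k+1}` depend, for
`j` in `{1, …, k}`. -/
def paramIndex {k : ℕ} (j : Fin k) : {ℓ : ℕ // 2 ≤ ℓ} := ⟨k + 1, by have := j.isLt; omega⟩

/-- The term with `ξ_{k+1} = a`, `ξ'_{k+1} = b` of the series that defines the Fourier coefficient
of `[B_{j,k+1}^+]^{ω_{k+1}} σ` at `(ξ; ξ')`:
`h_{ξ_j} h_{ξ_j-a+b} h_a h_b σ̂ (ξ₁, …, ξ_j - a + b, …, ξ_k, a; ξ'₁, …, ξ'_k, b)`,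
with the `h`'s evaluated at `ω_{k+1}`. -/
def collisionTermPlus (h : Freq → Ω → ℝ) {k : ℕ} (j : Fin k) (σ : RandomDM p (k + 1))
    (ξ ξ' : Fin k → Freq) (a b : Freq) (ω : OmegaStar Ω) : ℂ :=
  ((h (ξ j) (ω (paramIndex j)) * h (ξ j - a + b) (ω (paramIndex j)) *
      h a (ω (paramIndex j)) * h b (ω (paramIndex j)) : ℝ) : ℂ) *
    fourierCoeff (σ ω) (Fin.snoc (α := fun _ => Freq) (Function.update ξ j (ξ j - a + b)) a)
      (Fin.snoc (α := fun _ => Freq) ξ' b)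

/-- The term with `ξ_{k+1} = a`, `ξ'_{k+1} = b` of the series that defines the Fourier coefficient
of `[B_{j,k+1}^-]^{ω_{k+1}} σ` at `(ξ; ξ')`:
`h_{ξ'_j} h_{ξ'_j-b+a} h_a h_b σ̂ (ξ₁, …, ξ_k, a; ξ'₁, …, ξ'_j - b + a, …, ξ'_k, b)`,
with the `h`'s evaluated at `ω_{k+1}`. -/
def collisionTermMinus (h : Freq → Ω → ℝ) {k : ℕ} (j : Fin k) (σ : RandomDM p (k + 1))
    (ξ ξ' : Fin k → Freq) (a b : Freq) (ω : OmegaStar Ω) : ℂ :=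
  ((h (ξ' j) (ω (paramIndex j)) * h (ξ' j - b + a) (ω (paramIndex j)) *
      h a (ω (paramIndex j)) * h b (ω (paramIndex j)) : ℝ) : ℂ) *
    fourierCoeff (σ ω) (Fin.snoc (α := fun _ => Freq) ξ a)
      (Fin.snoc (α := fun _ => Freq) (Function.update ξ' j (ξ' j - b + a)) b)

/-- `τ` is the random density matrix whose Fourier coefficients are the sums over `a, b ∈ ℤ³` of
the given terms. The sums are unconditional sums in `L²(Ω*)`. (For `α ≤ 1` these series need not
converge absolutely for any fixed value of `ω*`.) -/
def HasCollisionSum {k : ℕ}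
    (term : (Fin k → Freq) → (Fin k → Freq) → Freq → Freq → OmegaStar Ω → ℂ)
    (τ : RandomDM p k) : Prop :=
  ∀ ξ ξ' : Fin k → Freq,
    Tendsto (fun F : Finset (Freq × Freq) =>
      eLpNorm (fun ω => fourierCoeff (τ ω) ξ ξ' - ∑ q ∈ F, term ξ ξ' q.1 q.2 ω) 2 (starMeasure p))
      atTop (𝓝 0)

/-- `τ = [B_{j,k+1}^+]^{ω_{k+1}} σ`. -/
def IsCollisionPlus (h : Freq → Ω → ℝ) {k : ℕ} (j : Fin k) (σ : RandomDM p (k + 1))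
    (τ : RandomDM p k) : Prop := HasCollisionSum (collisionTermPlus h j σ) τ

/-- `τ = [B_{j,k+1}^-]^{ω_{k+1}} σ`. -/
def IsCollisionMinus (h : Freq → Ω → ℝ) {k : ℕ} (j : Fin k) (σ : RandomDM p (k + 1))
    (τ : RandomDM p k) : Prop := HasCollisionSum (collisionTermMinus h j σ) τ

open Classical in
/-- The operator `[B_{j,k+1}^+]^{ω_{k+1}}` (with value `0` outside its domain). -/
def collisionPlus (h : Freq → Ω → ℝ) {k : ℕ} (j : Fin k) (σ : RandomDM p (k + 1)) :
    RandomDM p k :=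
  if H : ∃ τ, IsCollisionPlus h j σ τ then H.choose else 0

open Classical in
/-- The operator `[B_{j,k+1}^-]^{ω_{k+1}}` (with value `0` outside its domain). -/
def collisionMinus (h : Freq → Ω → ℝ) {k : ℕ} (j : Fin k) (σ : RandomDM p (k + 1)) :
    RandomDM p k :=
  if H : ∃ τ, IsCollisionMinus h j σ τ then H.choose else 0

/-- The full randomized collision operator
`[B^(k+1)]^{ω_{k+1}} = ∑_{j=1}^k ([B_{j,k+1}^+]^{ω_{k+1}} - [B_{j,k+1}^-]^{ω_{k+1}})`. -/
def collision (h : Freq → Ω → ℝ) (k : ℕ) (σ : RandomDM p (k + 1)) : RandomDM p k :=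
  ∑ j : Fin k, (collisionPlus h j σ - collisionMinus h j σ)

/-- `σ` belongs to the domain of all the operators `[B_{j,k+1}^±]^{ω_{k+1}}`, `1 ≤ j ≤ k`. -/
def InCollisionDomain (h : Freq → Ω → ℝ) (k : ℕ) (σ : RandomDM p (k + 1)) : Prop :=
  ∀ j : Fin k, (∃ τ, IsCollisionPlus h j σ τ) ∧ ∃ τ, IsCollisionMinus h j σ τ

/-! ### Sequences of density matrices, truncated solutions

Sequences `(σ^(k))` are indexed by all natural numbers `k`; only the orders `k ≥ 1` are used. -/

/-- The norm `∑_{k ≥ 1} ξ^k ‖σ^(k)‖_{H^α}` of `𝓗^α_ξ`. -/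
def hNorm (α ξ : ℝ) (Γ₀ : ∀ k, DensityMatrix k) : ℝ≥0∞ :=
  ∑' k : ℕ, ENNReal.ofReal ξ ^ (k + 1) * sobolevNorm α (Γ₀ (k + 1))

/-- The norm `∑_{k ≥ 1} ξ^k ‖σ^(k)‖_{L²(Ω*) H^α}` of `L²(Ω*) 𝓗^α_ξ`. -/
def randomHNorm (α ξ : ℝ) (Γ : ∀ k, RandomDM p k) : ℝ≥0∞ :=
  ∑' k : ℕ, ENNReal.ofReal ξ ^ (k + 1) * randomSobolevNorm α (Γ (k + 1))

/-- The norm of `L^∞_{t ∈ [0,T]} L²(Ω*) 𝓗^α_ξ`. -/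
def timeRandomHNorm (T α ξ : ℝ) (Γ : ∀ k, ℝ → RandomDM p k) : ℝ≥0∞ :=
  essSup (fun t => randomHNorm α ξ fun k => Γ k t) (volume.restrict (Set.Icc 0 T))

/-- Membership in `L^∞_{t ∈ [0,T]} L²(Ω*) 𝓗^α_ξ`. -/
def MemTimeRandomH (T α ξ : ℝ) (Γ : ∀ k, ℝ → RandomDM p k) : Prop :=
  (∀ k, 1 ≤ k → AEStronglyMeasurable (Γ k) (volume.restrict (Set.Icc 0 T))) ∧
    timeRandomHNorm T α ξ Γ < ∞

/-- The iterated integral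
`∫_0^t ∫_0^{t₁} ⋯ ∫_0^{t_{j-1}} Φ (U^(k)(t - t₁) [B^(k+1)] U^(k+1)(t₁ - t₂) [B^(k+2)] ⋯
  U^(k+j-1)(t_{j-1} - t_j) [B^(k+j)] U^(k+j)(t_j) γ₀^(k+j)) dt_j ⋯ dt₂ dt₁`. -/
def nestedDuhamel (h : Freq → Ω → ℝ) (Γ₀ : ∀ k, DensityMatrix k) {m : ℕ} :
    (j k : ℕ) → ℝ → (RandomDM p k → RandomDM p m) → RandomDM p m
  | 0, k, t, Φ => Φ (freeEvolutionR k t (constRandom p (Γ₀ k)))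
  | j + 1, k, t, Φ => ∫ s in (0 : ℝ)..t, nestedDuhamel h Γ₀ j (k + 1) s
      fun σ => Φ (freeEvolutionR k (t - s) (collision h k σ))

/-- The Duhamel term `Duh_j^{ω*}(Γ(0))^(k)(t)` of length `j`. -/
def duhamelTerm (h : Freq → Ω → ℝ) (Γ₀ : ∀ k, DensityMatrix k) (j k : ℕ) (t : ℝ) :
    RandomDM p k :=
  (-Complex.I) ^ j • nestedDuhamel h Γ₀ j k t id

/-- The solution `[γ_N^(k)]^{ω*}(t) = ∑_{j=0}^{N-k} Duh_j^{ω*}(Γ(0))^(k)(t)` of the truncated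
hierarchy; it vanishes for `k > N`. -/
def truncatedSolution (h : Freq → Ω → ℝ) (Γ₀ : ∀ k, DensityMatrix k) (N k : ℕ) (t : ℝ) :
    RandomDM p k :=
  ∑ j ∈ Finset.range (N + 1 - k), duhamelTerm h Γ₀ j k t

/-- The order `k` component of
`Γ(t) - U(t) Γ(0) + i ∫_0^t U(t-s) [B̂]^{ω*} Γ(s) ds`. -/
def duhamelDefect (h : Freq → Ω → ℝ) (Γ₀ : ∀ k, DensityMatrix k) (Γ : ∀ k, ℝ → RandomDM p k)
    (k : ℕ) (t : ℝ) : RandomDM p k :=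
  Γ k t - freeEvolutionR k t (constRandom p (Γ₀ k)) +
    Complex.I • ∫ s in (0 : ℝ)..t, freeEvolutionR k (t - s) (collision h k (Γ (k + 1) s))

/-- All the operations that occur in `duhamelDefect` are legitimate on `[0,T]`: for almost every
`s` the collision operators are defined at `Γ(s)`, and the Bochner integrals exist. -/
def DuhamelWellDefined (h : Freq → Ω → ℝ) (T : ℝ) (Γ : ∀ k, ℝ → RandomDM p k) : Prop :=
  (∀ᵐ s ∂(volume.restrict (Set.Icc 0 T)), ∀ k, 1 ≤ k → InCollisionDomain h k (Γ (k + 1) s)) ∧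
    ∀ t ∈ Set.Icc 0 T, ∀ k, 1 ≤ k → IntervalIntegrable
      (fun s => freeEvolutionR k (t - s) (collision h k (Γ (k + 1) s))) volume 0 t

end Random

end GPHierarchy

end

noncomputable section

namespace GPHierarchy

set_option linter.unusedSectionVars false

universe u

/-! ### Square summable families of vectors -/

section SquareSummable

variable {ι : Type*} {E : ι → Type*} [∀ i, NormedAddCommGroup (E i)]

/-! Randomization makes each collision operator bounded on $L^2(\Omega^*)H^\alpha$, without loss of
derivatives, provided its argument does not depend on $\omega_{k+1}$. In the Duhamel expansion this
always holds: the argument of $B^{(k+1)}$ involves only $\omega_\ell$ with $\ell>k+1$. Fix the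
output frequency $\eta$ ($\xi_j$ or $\xi'_j$). The signs are then independent of the coefficients,
and two terms $q=(a,b)$, $q'=(a',b')$ are orthogonal in $L^2(\Omega^*)$ unless every frequency
occurs an even number of times in the product of their eight signs. If neither term is resonant
($a=b$ or $a=\eta$), this forces $a',b'\in\{a,b,\eta-a+b\}$ (`exists_odd_count`). So non-resonant
terms are orthogonal up to nine neighbours, and adding them costs only a constant. Resonant terms
add up coherently; there the ratio of Sobolev weights is $\langle b\rangle^{-2\alpha}$, and
Cauchy–Schwarz costs $\sum_b\langle b\rangle^{-4\alpha}$, which converges in dimension three for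
$\alpha>3/4$. As output frequencies and $q$ are determined by the input frequencies, summation over
the output gives $\|B^{(k+1)}\|\le kc$ with $c=2\sqrt{\texttt{collisionConst}\,\alpha}$.

The rest is deterministic and is carried out for an abstract `Hierarchy`. In order $k+1$, $j$
collisions contribute $(k+1)\cdots(k+j)\,c^j$ and the time simplex $t^j/j!$, hence
$\binom{k+j}{j}(ct)^j\|\gamma_0^{(k+j+1)}\|$ (`norm_duhamel_le`). Since $\binom{k+j}{j}\le 2^k2^j$
and $2cT\le\xi'$, the full Duhamel series converges, its remainders are tails of
$\|\Gamma(0)\|_{\mathcal H^\alpha_{\xi'}}$ times a geometric series in $2\xi/\xi'$, and integration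
term by term shows that the sum solves the equation exactly.

The two halves are linked by `synth`, which rebuilds a random density matrix from its weighted
Fourier coefficients. These form a square summable family of functions of the tail of $\omega^*$, so
the required independence is built into the space `ModelSpace`; `synth` carries its norm to that of
$L^2(\Omega^*)H^\alpha$ and intertwines both dynamics. -/

theorem memℓp_two_iff {f : ∀ i, E i} : Memℓp f 2 ↔ Summable fun i => ‖f i‖ ^ 2 := by
  rw [memℓp_gen_iff (by norm_num)]
  simp

theorem summable_norm_sq (f : lp E 2) : Summable fun i => ‖f i‖ ^ 2 :=
  memℓp_two_iff.1 (lp.memℓp f)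

theorem lp_norm_sq (f : lp E 2) : ‖f‖ ^ 2 = ∑' i, ‖f i‖ ^ 2 := by
  have := lp.norm_rpow_eq_tsum (p := 2) (by norm_num) f
  simpa using this

end SquareSummable

/-! ### Almost orthogonal families -/

section AlmostOrthogonal

variable {Q : Type*} {E : Type*} [NormedAddCommGroup E] [InnerProductSpace ℂ E]

/-- Expand the square and bound each nonzero inner product by the mean of the two squared norms;
every vector is then counted at most `K` times. -/
theorem norm_sq_sum_le_of_almost_orthogonal {v : Q → E} {F : Finset Q} {K : ℕ}
    {nbr : Q → Finset Q} (hcard : ∀ q, (nbr q).card ≤ K)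
    (horth : ∀ q ∈ F, ∀ q' ∈ F, q' ∉ nbr q → inner ℂ (v q) (v q') = 0) :
    ‖∑ q ∈ F, v q‖ ^ 2 ≤ K * ∑ q ∈ F, ‖v q‖ ^ 2 := by
  classical
  -- Neighbourhoods need not be symmetric. Non-orthogonality is, and it is contained in them, so the
  -- double sum can be symmetrized.
  set P : Q → Q → Prop := fun q q' => inner ℂ (v q) (v q') ≠ 0 with hP
  have hsymm : ∀ q q', P q q' ↔ P q' q := fun q q' => by
    simp only [hP, ne_eq, inner_eq_zero_symm]
  have hcardF : ∀ q ∈ F, ((F.filter (P q)).card : ℝ) ≤ K := fun q hq => by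
    refine le_trans ?_ (Nat.cast_le.2 (hcard q))
    refine Nat.cast_le.2 (Finset.card_le_card fun q' hq' => ?_)
    rw [Finset.mem_filter] at hq'
    by_contra h
    exact hq'.2 (horth q hq q' hq'.1 h)
  have h1 : ‖∑ q ∈ F, v q‖ ^ 2 ≤
      ∑ q ∈ F, ∑ q' ∈ F, if P q q' then (‖v q‖ ^ 2 + ‖v q'‖ ^ 2) / 2 else 0 := by
    rw [← inner_self_eq_norm_sq (𝕜 := ℂ), sum_inner, map_sum]
    refine Finset.sum_le_sum fun q _ => ?_
    rw [inner_sum, map_sum]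
    refine Finset.sum_le_sum fun q' _ => ?_
    split_ifs with h
    · have := (RCLike.re_le_norm (inner ℂ (v q) (v q'))).trans (norm_inner_le_norm _ _)
      nlinarith [sq_nonneg (‖v q‖ - ‖v q'‖)]
    · have : inner ℂ (v q) (v q') = 0 := not_not.1 h
      simp [this]
  have h2 : ∀ f : Q → ℝ, ∑ q ∈ F, ∑ q' ∈ F, (if P q q' then f q else 0) =
      ∑ q ∈ F, (F.filter (P q)).card * f q := fun f => by
    refine Finset.sum_congr rfl fun q _ => ?_
    rw [← Finset.sum_filter, Finset.sum_const, nsmul_eq_mul]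
  have h3 : ∑ q ∈ F, ∑ q' ∈ F, (if P q q' then (‖v q‖ ^ 2 + ‖v q'‖ ^ 2) / 2 else 0) =
      ∑ q ∈ F, ∑ q' ∈ F, (if P q q' then ‖v q‖ ^ 2 else 0) := by
    have hsw : ∑ q ∈ F, ∑ q' ∈ F, (if P q q' then ‖v q'‖ ^ 2 else 0) =
        ∑ q ∈ F, ∑ q' ∈ F, (if P q q' then ‖v q‖ ^ 2 else 0) := by
      rw [Finset.sum_comm]
      simp only [hsymm]
    have hsp : ∑ q ∈ F, ∑ q' ∈ F, (if P q q' then (‖v q‖ ^ 2 + ‖v q'‖ ^ 2) / 2 else 0) =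
        (∑ q ∈ F, ∑ q' ∈ F, (if P q q' then ‖v q‖ ^ 2 else 0) +
          ∑ q ∈ F, ∑ q' ∈ F, (if P q q' then ‖v q'‖ ^ 2 else 0)) / 2 := by
      simp only [← Finset.sum_add_distrib, Finset.sum_div]
      refine Finset.sum_congr rfl fun q _ => Finset.sum_congr rfl fun q' _ => ?_
      split_ifs <;> simp
    rw [hsp, hsw]
    ring
  rw [h3, h2] at h1
  refine h1.trans ?_
  rw [Finset.mul_sum]
  exact Finset.sum_le_sum fun q hq => mul_le_mul_of_nonneg_right (hcardF q hq) (sq_nonneg _)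

/-- A family that is almost orthogonal off the exceptional set `bad`, with a square summable
majorant. -/
theorem norm_sq_sum_le_of_majorant {v : Q → E} {F : Finset Q} {K : ℕ} {nbr : Q → Finset Q}
    {bad : Q → Prop} {ρ d : Q → ℝ} {S R : ℝ} (hcard : ∀ q, (nbr q).card ≤ K)
    (horth : ∀ q q', ¬ bad q → ¬ bad q' → q' ∉ nbr q → inner ℂ (v q) (v q') = 0)
    (hv : ∀ q, ‖v q‖ ≤ ρ q * d q)
    (hS : ∀ G : Finset Q, (∀ q ∈ G, bad q) → ∑ q ∈ G, ρ q ^ 2 ≤ S) (hR : ∀ q, ρ q ^ 2 ≤ R) :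
    ‖∑ q ∈ F, v q‖ ^ 2 ≤ 2 * (S + K * R) * ∑ q ∈ F, d q ^ 2 := by
  classical
  have hS0 : 0 ≤ S := by simpa using hS ∅ (by simp)
  have hgood : ‖∑ q ∈ F with ¬ bad q, v q‖ ^ 2 ≤ K * R * ∑ q ∈ F, d q ^ 2 := by
    refine (norm_sq_sum_le_of_almost_orthogonal hcard fun q hq q' hq' h => ?_).trans ?_
    · exact horth q q' (Finset.mem_filter.1 hq).2 (Finset.mem_filter.1 hq').2 h
    rw [mul_assoc]
    refine mul_le_mul_of_nonneg_left ?_ (Nat.cast_nonneg _)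
    rw [Finset.mul_sum]
    refine (Finset.sum_le_sum fun q _ => ?_).trans
      (Finset.sum_le_sum_of_subset_of_nonneg (Finset.filter_subset _ _) fun q _ _ => ?_)
    · calc ‖v q‖ ^ 2 ≤ (ρ q * d q) ^ 2 := pow_le_pow_left₀ (norm_nonneg _) (hv q) 2
        _ = ρ q ^ 2 * d q ^ 2 := mul_pow _ _ _
        _ ≤ R * d q ^ 2 := mul_le_mul_of_nonneg_right (hR q) (sq_nonneg _)
    · exact mul_nonneg ((sq_nonneg _).trans (hR q)) (sq_nonneg _)
  -- No cancellation is available here: triangle inequality, then Cauchy–Schwarz.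
  have hbad : ‖∑ q ∈ F with bad q, v q‖ ^ 2 ≤ S * ∑ q ∈ F, d q ^ 2 := by
    calc ‖∑ q ∈ F with bad q, v q‖ ^ 2 ≤ (∑ q ∈ F with bad q, ρ q * d q) ^ 2 :=
          pow_le_pow_left₀ (norm_nonneg _) (norm_sum_le_of_le _ fun q _ => hv q) 2
      _ ≤ (∑ q ∈ F with bad q, ρ q ^ 2) * ∑ q ∈ F with bad q, d q ^ 2 :=
          Finset.sum_mul_sq_le_sq_mul_sq _ _ _
      _ ≤ S * ∑ q ∈ F, d q ^ 2 := by
          refine mul_le_mul (hS _ fun q hq => (Finset.mem_filter.1 hq).2)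
            (Finset.sum_le_sum_of_subset_of_nonneg (Finset.filter_subset _ _)
              fun q _ _ => sq_nonneg _) (Finset.sum_nonneg fun q _ => sq_nonneg _) hS0
  rw [← Finset.sum_filter_add_sum_filter_not F bad]
  have h1 := norm_add_le (∑ q ∈ F with bad q, v q) (∑ q ∈ F with ¬ bad q, v q)
  have h2 := pow_le_pow_left₀ (norm_nonneg _) h1 2
  nlinarith [sq_nonneg (‖∑ q ∈ F with bad q, v q‖ - ‖∑ q ∈ F with ¬ bad q, v q‖)]

omit [InnerProductSpace ℂ E] in
theorem summable_of_norm_sq_sum_le [CompleteSpace E] {v : Q → E} {d : Q → ℝ} {A : ℝ}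
    (h : ∀ F : Finset Q, ‖∑ q ∈ F, v q‖ ^ 2 ≤ A * ∑ q ∈ F, d q ^ 2)
    (hd : Summable fun q => d q ^ 2) : Summable v := by
  rw [summable_iff_vanishing_norm]
  intro ε hε
  have hA : 0 < |A| + 1 := by positivity
  obtain ⟨s, hs⟩ := summable_iff_vanishing_norm.1 hd (ε ^ 2 / (|A| + 1)) (by positivity)
  refine ⟨s, fun t ht => ?_⟩
  have h1 := hs t ht
  have h0 : 0 ≤ ∑ q ∈ t, d q ^ 2 := Finset.sum_nonneg fun q _ => sq_nonneg _
  rw [Real.norm_of_nonneg h0, lt_div_iff₀ hA] at h1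
  refine lt_of_pow_lt_pow_left₀ 2 hε.le ?_
  have := h t
  nlinarith [le_abs_self A]

omit [InnerProductSpace ℂ E] in
theorem norm_sq_tsum_le [CompleteSpace E] {v : Q → E} {d : Q → ℝ} {A : ℝ}
    (h : ∀ F : Finset Q, ‖∑ q ∈ F, v q‖ ^ 2 ≤ A * ∑ q ∈ F, d q ^ 2)
    (hd : Summable fun q => d q ^ 2) : ‖∑' q, v q‖ ^ 2 ≤ A * ∑' q, d q ^ 2 :=
  le_of_tendsto_of_tendsto (((summable_of_norm_sq_sum_le h hd).hasSum.norm).pow 2)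
    (hd.hasSum.mul_left A |>.congr fun _ => (Finset.mul_sum _ _ _).symm) (Eventually.of_forall h)

end AlmostOrthogonal

/-! ### Frequency weights -/

theorem one_le_japaneseBracket (ζ : Freq) : 1 ≤ japaneseBracket ζ :=
  Real.one_le_sqrt.2 (by have : 0 ≤ ∑ i, (ζ i : ℝ) ^ 2 := by positivity
                         linarith)

theorem japaneseBracket_pos (ζ : Freq) : 0 < japaneseBracket ζ :=
  zero_lt_one.trans_le (one_le_japaneseBracket ζ)

theorem japaneseBracket_sq (ζ : Freq) : japaneseBracket ζ ^ 2 = 1 + ∑ i, (ζ i : ℝ) ^ 2 :=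
  Real.sq_sqrt (by positivity)

theorem japaneseBracket_neg (ζ : Freq) : japaneseBracket (-ζ) = japaneseBracket ζ := by
  simp [japaneseBracket]

/-- Peetre's inequality, from $|x+y|^2\le 2|x|^2+2|y|^2$. -/
theorem japaneseBracket_add_sq_le (x y : Freq) :
    japaneseBracket (x + y) ^ 2 ≤ 2 * (japaneseBracket x ^ 2 * japaneseBracket y ^ 2) := by
  simp only [japaneseBracket_sq, Fin.sum_univ_three, Pi.add_apply, Int.cast_add]
  nlinarith [sq_nonneg ((x 0 : ℝ) - y 0), sq_nonneg ((x 1 : ℝ) - y 1),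
    sq_nonneg ((x 2 : ℝ) - y 2), mul_nonneg (add_nonneg (add_nonneg (sq_nonneg (x 0 : ℝ))
      (sq_nonneg (x 1 : ℝ))) (sq_nonneg (x 2 : ℝ))) (add_nonneg (add_nonneg (sq_nonneg (y 0 : ℝ))
      (sq_nonneg (y 1 : ℝ))) (sq_nonneg (y 2 : ℝ)))]

/-- The ratio `(⟨η⟩ / (⟨η - a + b⟩ ⟨a⟩ ⟨b⟩))^α`. -/
def weightRatio (α : ℝ) (η : Freq) (q : Freq × Freq) : ℝ :=
  japaneseBracket η ^ α / (japaneseBracket (η - q.1 + q.2) ^ α * japaneseBracket q.1 ^ α *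
    japaneseBracket q.2 ^ α)

theorem weightRatio_nonneg (α : ℝ) (η : Freq) (q : Freq × Freq) : 0 ≤ weightRatio α η q := by
  have h := fun ζ => (Real.rpow_pos_of_pos (japaneseBracket_pos ζ) α).le
  exact div_nonneg (h _) (mul_nonneg (mul_nonneg (h _) (h _)) (h _))

/-- Write $\eta=(\eta-a+b)+a-b$ and apply Peetre's inequality twice; each use costs a factor 2 on
squares. -/
theorem weightRatio_sq_le {α : ℝ} (hα : 0 ≤ α) (η : Freq) (q : Freq × Freq) :
    weightRatio α η q ^ 2 ≤ 4 ^ α := by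
  have h0 := japaneseBracket_pos
  have key : japaneseBracket η ^ 2 ≤ 4 * (japaneseBracket (η - q.1 + q.2) *
      japaneseBracket q.1 * japaneseBracket q.2) ^ 2 := by
    have h1 := japaneseBracket_add_sq_le (η - q.1 + q.2 + q.1) (-q.2)
    have h2 := japaneseBracket_add_sq_le (η - q.1 + q.2) q.1
    rw [japaneseBracket_neg, show η - q.1 + q.2 + q.1 + -q.2 = η by abel] at h1
    have h3 := mul_le_mul_of_nonneg_right h2 (sq_nonneg (japaneseBracket q.2))
    calc _ ≤ _ := h1
      _ ≤ _ := by nlinarith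
  have e : weightRatio α η q = (japaneseBracket η / (japaneseBracket (η - q.1 + q.2) *
      japaneseBracket q.1 * japaneseBracket q.2)) ^ α := by
    rw [Real.div_rpow (h0 _).le (mul_pos (mul_pos (h0 _) (h0 _)) (h0 _)).le,
      Real.mul_rpow (mul_pos (h0 _) (h0 _)).le (h0 _).le,
      Real.mul_rpow (h0 _).le (h0 _).le, weightRatio]
  have hx : 0 ≤ japaneseBracket η / (japaneseBracket (η - q.1 + q.2) *
      japaneseBracket q.1 * japaneseBracket q.2) := by
    have := h0 (η - q.1 + q.2); have := h0 q.1; have := h0 q.2; have := h0 η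
    positivity
  rw [e, ← Real.rpow_natCast, ← Real.rpow_mul hx, mul_comm α, Real.rpow_mul hx]
  refine Real.rpow_le_rpow (by positivity) ?_ hα
  rw [Nat.cast_ofNat, Real.rpow_two, div_pow, div_le_iff₀]
  · exact key
  · have := h0 (η - q.1 + q.2); have := h0 q.1; have := h0 q.2
    positivity

/-- For $a=b$ the shifted frequency is $\eta$ itself and cancels the numerator, leaving only the
decay in $a$. -/
theorem weightRatio_diag_sq (α : ℝ) (η a : Freq) :
    weightRatio α η (a, a) ^ 2 = japaneseBracket a ^ (-4 * α) := by
  have h := fun ζ => Real.rpow_pos_of_pos (japaneseBracket_pos ζ) α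
  have e : weightRatio α η (a, a) = (japaneseBracket a ^ α * japaneseBracket a ^ α)⁻¹ := by
    have h1 := h η; have h2 := h a
    simp only [weightRatio, sub_add_cancel]
    field_simp
  rw [e, ← Real.rpow_add (japaneseBracket_pos a), ← Real.rpow_neg (japaneseBracket_pos a).le,
    ← Real.rpow_natCast, ← Real.rpow_mul (japaneseBracket_pos a).le]
  congr 1
  push_cast
  ring

/-- For $a=\eta$ the shifted frequency is $b$, and $\langle a\rangle$ cancels the numerator: the
same value as on the diagonal. -/
theorem weightRatio_self_sq (α : ℝ) (η b : Freq) :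
    weightRatio α η (η, b) ^ 2 = japaneseBracket b ^ (-4 * α) := by
  have h := fun ζ => Real.rpow_pos_of_pos (japaneseBracket_pos ζ) α
  have e : weightRatio α η (η, b) = weightRatio α η (b, b) := by
    have h1 := h η; have h2 := h b
    simp only [weightRatio, sub_add_cancel, sub_self, zero_add]
    field_simp
  rw [e, weightRatio_diag_sq]

theorem summable_one_add_sq_rpow {s : ℝ} (hs : 1 / 2 < s) :
    Summable fun n : ℤ => (1 + (n : ℝ) ^ 2) ^ (-s) := by
  have h1 : Summable fun n : ℤ => |(n : ℝ)| ^ (-(2 * s)) :=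
    Real.summable_abs_int_rpow (by linarith)
  refine Summable.of_norm_bounded_eventually h1 ?_
  -- The comparison fails at $n=0$, where the real power of $0$ takes the value $0$.
  have : ∀ᶠ n : ℤ in cofinite, n ≠ 0 := by
    simpa using (Set.finite_singleton (0 : ℤ)).compl_mem_cofinite
  filter_upwards [this] with n hn
  have hn' : 0 < (n : ℝ) ^ 2 := by positivity
  rw [Real.norm_of_nonneg (by positivity), show -(2 * s) = 2 * (-s) by ring,
    Real.rpow_mul (abs_nonneg _), Real.rpow_two, sq_abs]
  exact Real.rpow_le_rpow_of_nonpos hn' (by linarith) (by linarith)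

/-- The source of the condition $\alpha>3/4$. Since $(1+x)(1+y)(1+z)\le(1+x+y+z)^3$, the summand is
at most a product of three one-dimensional factors $(1+n^2)^{-2\alpha/3}$, summable because
$4\alpha/3>1$. -/
theorem summable_japaneseBracket_rpow {α : ℝ} (hα : 3 / 4 < α) :
    Summable fun ζ : Freq => japaneseBracket ζ ^ (-4 * α) := by
  have h1 := summable_one_add_sq_rpow (s := 2 * α / 3) (by linarith)
  set g : ℤ → ℝ := fun n => (1 + (n : ℝ) ^ 2) ^ (-(2 * α / 3)) with hg
  have hg0 : ∀ n, 0 ≤ g n := fun n => by positivity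
  have h3 : Summable fun x : ℤ × ℤ × ℤ => g x.1 * (g x.2.1 * g x.2.2) :=
    h1.mul_of_nonneg (h1.mul_of_nonneg h1 hg0 hg0) hg0 fun x => mul_nonneg (hg0 _) (hg0 _)
  have hinj : Function.Injective fun ζ : Freq => (ζ 0, ζ 1, ζ 2) := fun x y h => by
    simp only [Prod.mk.injEq] at h
    ext i
    fin_cases i
    exacts [h.1, h.2.1, h.2.2]
  refine Summable.of_nonneg_of_le (fun ζ => (Real.rpow_pos_of_pos (japaneseBracket_pos ζ) _).le)
    (fun ζ => ?_) (h3.comp_injective hinj)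
  simp only [Function.comp, hg]
  have hb : japaneseBracket ζ ^ (-4 * α) =
      (((japaneseBracket ζ) ^ 2) ^ 3) ^ (-(2 * α / 3)) := by
    rw [← pow_mul, ← Real.rpow_natCast, ← Real.rpow_mul (japaneseBracket_pos ζ).le]
    congr 1
    push_cast
    ring
  rw [hb, ← Real.mul_rpow (by positivity) (by positivity),
    ← Real.mul_rpow (by positivity) (by positivity)]
  refine Real.rpow_le_rpow_of_nonpos (by positivity) ?_ (by linarith)
  rw [japaneseBracket_sq, Fin.sum_univ_three]
  set x := (ζ 0 : ℝ) ^ 2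
  set y := (ζ 1 : ℝ) ^ 2
  set z := (ζ 2 : ℝ) ^ 2
  have hx : 0 ≤ x := sq_nonneg _
  have hy : 0 ≤ y := sq_nonneg _
  have hz : 0 ≤ z := sq_nonneg _
  have hX : 1 + x ≤ 1 + (x + y + z) := by linarith
  have hY : 1 + y ≤ 1 + (x + y + z) := by linarith
  have hZ : 1 + z ≤ 1 + (x + y + z) := by linarith
  calc (1 + x) * ((1 + y) * (1 + z)) ≤
      (1 + (x + y + z)) * ((1 + (x + y + z)) * (1 + (x + y + z))) := by gcongr
    _ = _ := by ring

/-- The pairs `(a, b)` for which the terms of the collision operator add up coherently. -/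
def IsResonant (η : Freq) (q : Freq × Freq) : Prop := q.1 = q.2 ∨ q.1 = η

/-- Each of the two resonant classes is parametrized injectively by $b$, and contributes at most one
full sum of $\langle b\rangle^{-4\alpha}$. -/
theorem sum_resonant_weightRatio_sq_le {α : ℝ} (hα : 3 / 4 < α) (η : Freq)
    (G : Finset (Freq × Freq)) (hG : ∀ q ∈ G, IsResonant η q) :
    ∑ q ∈ G, weightRatio α η q ^ 2 ≤ 2 * ∑' ζ : Freq, japaneseBracket ζ ^ (-4 * α) := by
  classical
  have hs := summable_japaneseBracket_rpow hα
  have h0 : ∀ ζ : Freq, 0 ≤ japaneseBracket ζ ^ (-4 * α) :=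
    fun ζ => (Real.rpow_pos_of_pos (japaneseBracket_pos ζ) _).le
  have key : ∀ G' : Finset (Freq × Freq), Set.InjOn Prod.snd (G' : Set (Freq × Freq)) →
      ∑ q ∈ G', japaneseBracket q.2 ^ (-4 * α) ≤
        ∑' ζ : Freq, japaneseBracket ζ ^ (-4 * α) := fun G' hinj => by
    rw [← Finset.sum_image (f := fun ζ : Freq => japaneseBracket ζ ^ (-4 * α)) hinj]
    exact hs.sum_le_tsum _ fun ζ _ => h0 ζ
  rw [← Finset.sum_filter_add_sum_filter_not G (fun q => q.1 = q.2), two_mul]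
  refine add_le_add ?_ ?_
  · rw [Finset.sum_congr rfl fun q hq => ?_]
    · refine key (G.filter fun q => q.1 = q.2) fun q hq q' hq' h => ?_
      simp only [Finset.coe_filter, Set.mem_ofPred_eq] at hq hq'
      exact Prod.ext (hq.2.trans (h.trans hq'.2.symm)) h
    · obtain ⟨a, b⟩ := q
      obtain rfl : a = b := (Finset.mem_filter.1 hq).2
      exact weightRatio_diag_sq α η a
  · rw [Finset.sum_congr rfl fun q hq => ?_]
    · refine key (G.filter fun q => ¬ q.1 = q.2) fun q hq q' hq' h => ?_
      simp only [Finset.coe_filter, Set.mem_ofPred_eq] at hq hq'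
      have e1 := (hG q hq.1).resolve_left hq.2
      have e2 := (hG q' hq'.1).resolve_left hq'.2
      exact Prod.ext (e1.trans e2.symm) h
    · obtain ⟨a, b⟩ := q
      rw [Finset.mem_filter] at hq
      obtain rfl : a = η := (hG _ hq.1).resolve_left hq.2
      exact weightRatio_self_sq α a b

/-! ### Diagonal operators -/

section Diagonal

variable {ι : Type*} {A : Type*} [NormedAddCommGroup A] [NormedSpace ℂ A]

/-- The multiplication of a square summable family of vectors by a bounded family of scalars. -/
def diagMul (c : ι → ℂ) (hc : ∀ i, ‖c i‖ ≤ 1) :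
    lp (fun _ : ι => A) 2 →L[ℂ] lp (fun _ : ι => A) 2 :=
  LinearMap.mkContinuous
    { toFun := fun f => ⟨fun i => c i • f i, memℓp_two_iff.2 <|
        (summable_norm_sq f).of_nonneg_of_le (fun _ => sq_nonneg _) fun i => by
          rw [norm_smul]
          exact pow_le_pow_left₀ (by positivity)
            (mul_le_of_le_one_left (norm_nonneg _) (hc i)) 2⟩
      map_add' := fun f g => by ext i; exact smul_add _ _ _
      map_smul' := fun a f => by ext i; exact smul_comm _ _ _ } 1 fun f => by
    rw [one_mul]
    exact lp.norm_mono (by norm_num) fun i => by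
      change ‖c i • f i‖ ≤ _
      rw [norm_smul]
      exact mul_le_of_le_one_left (norm_nonneg _) (hc i)

@[simp]
theorem diagMul_apply (c : ι → ℂ) (hc : ∀ i, ‖c i‖ ≤ 1) (f : lp (fun _ : ι => A) 2) (i : ι) :
    diagMul c hc f i = c i • f i := rfl

theorem norm_diagMul_of_norm_eq_one {c : ι → ℂ} (hc : ∀ i, ‖c i‖ = 1)
    (f : lp (fun _ : ι => A) 2) : ‖diagMul c (fun i => (hc i).le) f‖ = ‖f‖ := by
  refine le_antisymm (lp.norm_mono (by norm_num) fun i => ?_)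
    (lp.norm_mono (by norm_num) fun i => ?_) <;>
  simp [norm_smul, hc]

/-- Only strong continuity holds in general. Finitely supported truncations of `f` depend
continuously on `t`, and they approximate uniformly in `t` because all multipliers are contractions.
-/
theorem continuous_diagMul {c : ℝ → ι → ℂ} (hc : ∀ t i, ‖c t i‖ ≤ 1)
    (hcont : ∀ i, Continuous fun t => c t i) (f : lp (fun _ : ι => A) 2) :
    Continuous fun t => diagMul (c t) (hc t) f := by
  classical
  have hsum := lp.hasSum_single (p := 2) (by norm_num) f
  have hle : ∀ t (g : lp (fun _ : ι => A) 2), ‖diagMul (c t) (hc t) g‖ ≤ ‖g‖ := fun t g =>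
    lp.norm_mono (by norm_num) fun i => by
      rw [diagMul_apply, norm_smul]
      exact mul_le_of_le_one_left (norm_nonneg _) (hc t i)
  refine continuous_of_uniform_approx_of_continuous fun u hu => ?_
  obtain ⟨ε, hε, hεu⟩ := Metric.mem_uniformity_dist.1 hu
  obtain ⟨F, hF⟩ := (Metric.tendsto_nhds.1 hsum ε hε).exists
  refine ⟨fun t => diagMul (c t) (hc t) (∑ i ∈ F, lp.single 2 i (f i)), ?_, fun t => hεu ?_⟩
  · simp only [map_sum]
    refine continuous_finsetSum _ fun i _ => ?_
    have : ∀ t, diagMul (c t) (hc t) (lp.single 2 i (f i)) = c t i • lp.single 2 i (f i) := by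
      intro t
      ext j
      by_cases h : j = i
      · subst h
        simp
      · simp [Pi.single_eq_of_ne h]
    simp only [this]
    exact (hcont i).smul continuous_const
  · rw [dist_eq_norm, ← map_sub]
    refine (hle _ _).trans_lt ?_
    rwa [← dist_eq_norm, dist_comm]

end Diagonal

/-! ### Collision operators on square summable families -/

/-- The frequencies that can occur in a term which is correlated with the term `q`. -/
def collisionNeighbours (η : Freq) (q : Freq × Freq) : Finset (Freq × Freq) :=
  ({q.1, q.2, η - q.1 + q.2} : Finset Freq) ×ˢ ({q.1, q.2, η - q.1 + q.2} : Finset Freq)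

theorem card_collisionNeighbours_le (η : Freq) (q : Freq × Freq) :
    (collisionNeighbours η q).card ≤ 9 := by
  rw [collisionNeighbours, Finset.card_product]
  exact Nat.mul_le_mul Finset.card_le_three Finset.card_le_three

section Collision

variable {A B : Type*} [NormedAddCommGroup A] [InnerProductSpace ℂ A]
  [NormedAddCommGroup B] [InnerProductSpace ℂ B]

/-- Contractions indexed by the terms of the collision operator; those which belong to different
non-resonant terms have orthogonal ranges, up to finitely many. -/
structure IsSignFamily (S : Freq → Freq × Freq → A →L[ℂ] B) : Prop where
  norm_le : ∀ η q c, ‖S η q c‖ ≤ ‖c‖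
  inner_eq_zero : ∀ η q q' c c', ¬ IsResonant η q → ¬ IsResonant η q' →
    q' ∉ collisionNeighbours η q → inner ℂ (S η q c) (S η q' c') = 0

variable {I I' : Type*}

/-- The terms of the series for the component `n` of a collision operator. -/
def modelTerm (S : Freq → Freq × Freq → A →L[ℂ] B) (α : ℝ) (η : I → Freq)
    (m : I → Freq × Freq → I') (v : lp (fun _ : I' => A) 2) (n : I) (q : Freq × Freq) : B :=
  (weightRatio α (η n) q : ℂ) • S (η n) q (v (m n q))

/-- The square of the constant in the collision estimate. -/
def collisionConst (α : ℝ) : ℝ :=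
  2 * (2 * ∑' ζ : Freq, japaneseBracket ζ ^ (-4 * α) + (9 : ℕ) * 4 ^ α)

theorem collisionConst_pos (α : ℝ) : 0 < collisionConst α := by
  have : 0 ≤ ∑' ζ : Freq, japaneseBracket ζ ^ (-4 * α) :=
    tsum_nonneg fun ζ => (Real.rpow_pos_of_pos (japaneseBracket_pos ζ) _).le
  have : (0 : ℝ) < 4 ^ α := by positivity
  rw [collisionConst]
  positivity

variable {S : Freq → Freq × Freq → A →L[ℂ] B} {α : ℝ} {η : I → Freq}
  {m : I → Freq × Freq → I'}

/-- This explains `collisionConst`: two resonant classes, plus nine neighbours times the bound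
$4^\alpha$ of the squared weight ratio, doubled to separate resonant from non-resonant terms. -/
theorem norm_sq_sum_modelTerm_le (hS : IsSignFamily S) (hα : 3 / 4 < α)
    (v : lp (fun _ : I' => A) 2) (n : I) (F : Finset (Freq × Freq)) :
    ‖∑ q ∈ F, modelTerm S α η m v n q‖ ^ 2 ≤ collisionConst α * ∑ q ∈ F, ‖v (m n q)‖ ^ 2 := by
  refine norm_sq_sum_le_of_majorant (bad := IsResonant (η n)) (ρ := weightRatio α (η n))
    (card_collisionNeighbours_le (η n))
    (fun q q' h h' hn => ?_) (fun q => ?_) (fun G hG => ?_) (fun q => ?_)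
  · rw [modelTerm, modelTerm, inner_smul_left, inner_smul_right,
      hS.inner_eq_zero _ _ _ _ _ h h' hn, mul_zero, mul_zero]
  · rw [modelTerm, norm_smul, Complex.norm_of_nonneg (weightRatio_nonneg _ _ _)]
    exact mul_le_mul_of_nonneg_left (hS.norm_le _ _ _) (weightRatio_nonneg _ _ _)
  · exact sum_resonant_weightRatio_sq_le hα _ G hG
  · exact weightRatio_sq_le (by linarith) _ _

omit [InnerProductSpace ℂ A] in
theorem summable_norm_sq_comp (hm : Function.Injective (Function.uncurry m))
    (v : lp (fun _ : I' => A) 2) : Summable fun x : I × (Freq × Freq) => ‖v (m x.1 x.2)‖ ^ 2 :=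
  (summable_norm_sq v).comp_injective hm

variable [CompleteSpace B]

theorem summable_modelTerm (hS : IsSignFamily S) (hα : 3 / 4 < α)
    (hm : Function.Injective (Function.uncurry m)) (v : lp (fun _ : I' => A) 2) (n : I) :
    Summable (modelTerm S α η m v n) :=
  summable_of_norm_sq_sum_le (norm_sq_sum_modelTerm_le hS hα v n)
    ((summable_norm_sq_comp hm v).prod_factor n)

theorem norm_sq_tsum_modelTerm_le (hS : IsSignFamily S) (hα : 3 / 4 < α)
    (hm : Function.Injective (Function.uncurry m)) (v : lp (fun _ : I' => A) 2) (n : I) :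
    ‖∑' q, modelTerm S α η m v n q‖ ^ 2 ≤ collisionConst α * ∑' q, ‖v (m n q)‖ ^ 2 :=
  norm_sq_tsum_le (norm_sq_sum_modelTerm_le hS hα v n) ((summable_norm_sq_comp hm v).prod_factor n)

theorem summable_norm_sq_tsum_modelTerm (hS : IsSignFamily S) (hα : 3 / 4 < α)
    (hm : Function.Injective (Function.uncurry m)) (v : lp (fun _ : I' => A) 2) :
    Summable fun n => ‖∑' q, modelTerm S α η m v n q‖ ^ 2 :=
  ((summable_norm_sq_comp hm v).prod.mul_left _).of_nonneg_of_le (fun _ => sq_nonneg _)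
    (norm_sq_tsum_modelTerm_le hS hα hm v)

/-- The collision operator on square summable families of vectors, as a linear map. -/
def modelCollisionLinear (hS : IsSignFamily S) (hα : 3 / 4 < α) (η : I → Freq)
    (hm : Function.Injective (Function.uncurry m)) :
    lp (fun _ : I' => A) 2 →ₗ[ℂ] lp (fun _ : I => B) 2 where
  toFun v := ⟨fun n => ∑' q, modelTerm S α η m v n q,
    memℓp_two_iff.2 (summable_norm_sq_tsum_modelTerm hS hα hm v)⟩
  map_add' v w := by
    ext n
    change ∑' q, modelTerm S α η m (v + w) n q =
      ∑' q, modelTerm S α η m v n q + ∑' q, modelTerm S α η m w n q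
    rw [← (summable_modelTerm hS hα hm v n).tsum_add (summable_modelTerm hS hα hm w n)]
    exact tsum_congr fun q => by simp [modelTerm]
  map_smul' a v := by
    ext n
    change ∑' q, modelTerm S α η m (a • v) n q = a • ∑' q, modelTerm S α η m v n q
    rw [← (summable_modelTerm hS hα hm v n).tsum_const_smul a]
    exact tsum_congr fun q => by simp [modelTerm, smul_comm a]

/-- By injectivity of `m`, each coefficient of `v` enters at most one term of one component, so
summation over `n` loses nothing. -/
theorem norm_modelCollisionLinear_le (hS : IsSignFamily S) (hα : 3 / 4 < α)
    (hm : Function.Injective (Function.uncurry m)) (v : lp (fun _ : I' => A) 2) :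
    ‖modelCollisionLinear hS hα η hm v‖ ≤ Real.sqrt (collisionConst α) * ‖v‖ := by
  refine le_of_sq_le_sq ?_ (by positivity)
  rw [mul_pow, Real.sq_sqrt (collisionConst_pos α).le, lp_norm_sq, lp_norm_sq]
  calc _ ≤ ∑' n, collisionConst α * ∑' q, ‖v (m n q)‖ ^ 2 :=
        (summable_norm_sq_tsum_modelTerm hS hα hm v).tsum_le_tsum
          (norm_sq_tsum_modelTerm_le hS hα hm v) ((summable_norm_sq_comp hm v).prod.mul_left _)
    _ = collisionConst α * ∑' x : I × (Freq × Freq), ‖v (m x.1 x.2)‖ ^ 2 := by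
        rw [tsum_mul_left, (summable_norm_sq_comp hm v).tsum_prod]
    _ ≤ _ := mul_le_mul_of_nonneg_left
        (tsum_comp_le_tsum_of_inj (summable_norm_sq v) (fun _ => sq_nonneg _) hm)
        (collisionConst_pos α).le

/-- The collision operator on square summable families of vectors. -/
def modelCollision (hS : IsSignFamily S) (hα : 3 / 4 < α) (η : I → Freq)
    (hm : Function.Injective (Function.uncurry m)) :
    lp (fun _ : I' => A) 2 →L[ℂ] lp (fun _ : I => B) 2 :=
  (modelCollisionLinear hS hα η hm).mkContinuous _ (norm_modelCollisionLinear_le hS hα hm)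

theorem hasSum_modelCollision (hS : IsSignFamily S) (hα : 3 / 4 < α)
    (hm : Function.Injective (Function.uncurry m)) (v : lp (fun _ : I' => A) 2) (n : I) :
    HasSum (modelTerm S α η m v n) (modelCollision hS hα η hm v n) :=
  (summable_modelTerm hS hα hm v n).hasSum

theorem norm_modelCollision_le (hS : IsSignFamily S) (hα : 3 / 4 < α)
    (hm : Function.Injective (Function.uncurry m)) :
    ‖modelCollision hS hα η hm‖ ≤ Real.sqrt (collisionConst α) :=
  LinearMap.mkContinuous_norm_le _ (Real.sqrt_nonneg _) (norm_modelCollisionLinear_le hS hα hm)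

end Collision

/-! ### Multiplication by random signs -/

section SignMul

variable {X : Type*} [MeasurableSpace X] {μ : Measure X}

theorem memLp_unimodular_mul {s : X → ℂ} (hs : AEStronglyMeasurable s μ)
    (hs1 : ∀ᵐ x ∂μ, ‖s x‖ = 1) (f : Lp ℂ 2 μ) : MemLp (fun x => s x * f x) 2 μ := by
  refine (Lp.memLp f).of_le (hs.mul (Lp.aestronglyMeasurable f)) ?_
  filter_upwards [hs1] with x hx
  rw [norm_mul, hx, one_mul]

/-- The multiplication by a function of modulus one, on `L²`. -/
def unimodularMulLp (s : X → ℂ) (hs : AEStronglyMeasurable s μ) (hs1 : ∀ᵐ x ∂μ, ‖s x‖ = 1) :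
    Lp ℂ 2 μ →ₗᵢ[ℂ] Lp ℂ 2 μ where
  toFun f := (memLp_unimodular_mul hs hs1 f).toLp _
  map_add' f g := by
    rw [← MemLp.toLp_add]
    refine MemLp.toLp_congr _ _ ?_
    filter_upwards [Lp.coeFn_add f g] with x hx
    change s x * (f + g : Lp ℂ 2 μ) x = _
    rw [hx]
    exact mul_add _ _ _
  map_smul' a f := by
    rw [RingHom.id_apply, ← MemLp.toLp_const_smul]
    refine MemLp.toLp_congr _ _ ?_
    filter_upwards [Lp.coeFn_smul a f] with x hx
    simp [hx, mul_left_comm]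
  norm_map' f := by
    change ‖(memLp_unimodular_mul hs hs1 f).toLp _‖ = _
    rw [Lp.norm_toLp, Lp.norm_def]
    congr 1
    refine eLpNorm_congr_norm_ae ?_
    filter_upwards [hs1] with x hx
    rw [norm_mul, hx, one_mul]

theorem coeFn_unimodularMulLp {s : X → ℂ} (hs : AEStronglyMeasurable s μ)
    (hs1 : ∀ᵐ x ∂μ, ‖s x‖ = 1) (f : Lp ℂ 2 μ) :
    unimodularMulLp s hs hs1 f =ᵐ[μ] fun x => s x * f x :=
  MemLp.coeFn_toLp (memLp_unimodular_mul hs hs1 f)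

end SignMul

/-! ### Expectations of products of signs -/

section Bernoulli

variable {Ω : Type u} [MeasurableSpace Ω] {p : Measure Ω} [IsProbabilityMeasure p]
  {h : Freq → Ω → ℝ}

theorem IsBernoulliFamily.ae_eq_one_or (hh : IsBernoulliFamily p h) (ζ : Freq) :
    ∀ᵐ ω ∂p, h ζ ω = 1 ∨ h ζ ω = -1 := by
  have hm : ∀ c : ℝ, MeasurableSet {ω | h ζ ω = c} := fun c =>
    hh.measurable ζ (measurableSet_singleton c)
  have hd : Disjoint {ω | h ζ ω = 1} {ω | h ζ ω = -1} := by
    rw [Set.disjoint_left]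
    intro ω h1 h2
    have h1' : h ζ ω = 1 := h1
    have h2' : h ζ ω = -1 := h2
    linarith
  have e : p ({ω | h ζ ω = 1} ∪ {ω | h ζ ω = -1}) = 1 := by
    rw [measure_union hd (hm _), hh.prob_one, hh.prob_neg_one, ENNReal.add_halves]
  exact (prob_compl_eq_zero_iff ((hm _).union (hm _))).2 e

theorem IsBernoulliFamily.integral_eq_zero (hh : IsBernoulliFamily p h) (ζ : Freq) :
    ∫ ω, h ζ ω ∂p = 0 := by
  have hm : ∀ c : ℝ, MeasurableSet {ω | h ζ ω = c} := fun c =>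
    hh.measurable ζ (measurableSet_singleton c)
  have e : h ζ =ᵐ[p] fun ω => {ω | h ζ ω = 1}.indicator (fun _ => (1 : ℝ)) ω -
      {ω | h ζ ω = -1}.indicator (fun _ => (1 : ℝ)) ω := by
    filter_upwards [hh.ae_eq_one_or ζ] with ω hω
    rcases hω with hω | hω <;> norm_num [Set.indicator, hω]
  rw [integral_congr_ae e, integral_sub, integral_indicator_const _ (hm _),
    integral_indicator_const _ (hm _), Measure.real, Measure.real, hh.prob_one, hh.prob_neg_one,
    sub_self]
  · exact (integrable_const _).indicator (hm _)
  · exact (integrable_const _).indicator (hm _)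

/-- Group the factors by frequency. An odd power of a sign is the sign itself, of mean zero, and
independence splits this factor off. -/
theorem IsBernoulliFamily.integral_prod_eq_zero (hh : IsBernoulliFamily p h) {l : List Freq}
    {ζ : Freq} (hζ : Odd (l.count ζ)) : ∫ ω, (l.map fun z => h z ω).prod ∂p = 0 := by
  set f : Freq → Ω → ℝ := fun z ω => h z ω ^ l.count z with hf
  have hmeas : ∀ z, Measurable (f z) := fun z => (hh.measurable z).pow_const _
  have hind : ProbabilityTheory.iIndepFun f p :=
    hh.indep.comp (fun z x => x ^ l.count z) fun z => measurable_id.pow_const _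
  have hmem : ζ ∈ l.toFinset := by
    rw [List.mem_toFinset, ← List.count_pos_iff]
    exact hζ.pos
  have e : ∀ ω, (l.map fun z => h z ω).prod = (∏ z ∈ l.toFinset.erase ζ, f z) ω * f ζ ω := by
    intro ω
    rw [Finset.prod_list_map_count, ← Finset.prod_erase_mul _ _ hmem, Finset.prod_apply]
  have e0 : ∫ ω, f ζ ω ∂p = 0 := by
    rw [← hh.integral_eq_zero ζ]
    refine integral_congr_ae ?_
    filter_upwards [hh.ae_eq_one_or ζ] with ω hω
    rcases hω with hω | hω <;> simp [hf, hω, hζ]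
  have hprod : Measurable (∏ z ∈ l.toFinset.erase ζ, f z) :=
    by
    rw [Finset.prod_fn]
    exact Finset.measurable_prod _ fun z _ => hmeas z
  simp only [e]
  rw [(hind.indepFun_finsetProd_of_notMem hmeas
    (Finset.notMem_erase ζ l.toFinset)).integral_fun_mul_eq_mul_integral
    hprod.aestronglyMeasurable (hmeas ζ).aestronglyMeasurable, e0, mul_zero]

/-- The product of signs in the term `q = (a, b)` of a collision operator. -/
def signProd (h : Freq → Ω → ℝ) (η : Freq) (q : Freq × Freq) (ω : Ω) : ℝ :=
  h η ω * h (η - q.1 + q.2) ω * h q.1 ω * h q.2 ω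

theorem IsBernoulliFamily.measurable_signProd (hh : IsBernoulliFamily p h) (η : Freq)
    (q : Freq × Freq) : Measurable (signProd h η q) :=
  (((hh.measurable _).mul (hh.measurable _)).mul (hh.measurable _)).mul (hh.measurable _)

theorem IsBernoulliFamily.ae_abs_signProd (hh : IsBernoulliFamily p h) (η : Freq)
    (q : Freq × Freq) : ∀ᵐ ω ∂p, |signProd h η q ω| = 1 := by
  have key : ∀ ζ, ∀ᵐ ω ∂p, |h ζ ω| = 1 := fun ζ => by
    filter_upwards [hh.ae_eq_one_or ζ] with ω hω
    rcases hω with hω | hω <;> simp [hω]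
  filter_upwards [key η, key (η - q.1 + q.2), key q.1, key q.2] with ω h1 h2 h3 h4
  simp [signProd, abs_mul, h1, h2, h3, h4]

/-- With $x=\eta-a+b$ and $x'=\eta-a'+b'$, the two copies of $\eta$ do not affect parity, so six
letters remain. Non-resonance means that $b$ differs from $a$ and $x$, and $b'$ from $a'$ and $x'$;
within one term only $x=a$ or $x'=a'$ can cancel. -/
theorem exists_odd_count {η : Freq} {q q' : Freq × Freq} (hq : ¬ IsResonant η q)
    (hq' : ¬ IsResonant η q') (hn : q' ∉ collisionNeighbours η q) :
    ∃ ζ, Odd ([η, η - q.1 + q.2, q.1, q.2, η, η - q'.1 + q'.2, q'.1, q'.2].count ζ) := by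
  obtain ⟨a, b⟩ := q
  obtain ⟨a', b'⟩ := q'
  simp only [IsResonant, not_or] at hq hq'
  simp only [collisionNeighbours, Finset.mem_product, Finset.mem_insert,
    Finset.mem_singleton] at hn
  have h2 : η - a + b ≠ b := fun e => hq.2 (sub_eq_zero.1 (add_eq_right.1 e)).symm
  have h4 : η - a' + b' ≠ b' := fun e => hq'.2 (sub_eq_zero.1 (add_eq_right.1 e)).symm
  -- If $x=a$, then $2a=\eta+b$, so $b$ determines $a$.
  have h6 : η - a + b = a → η - a' + b' = a' → b = b' → a = a' := fun e e' hb => by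
    subst hb
    ext i
    have := congrFun e i
    have := congrFun e' i
    simp only [Pi.add_apply, Pi.sub_apply] at *
    omega
  have h1 := hq.1
  have h3 := hq'.1
  generalize η - a + b = x at *
  generalize η - a' + b' = x' at *
  simp only at *
  clear hq hq'
  have key : ∀ ζ, Odd ([x, a, b, x', a', b'].count ζ) →
      Odd ([η, x, a, b, η, x', a', b'].count ζ) := by
    intro ζ h
    simp only [List.count_cons, List.count_nil, Nat.odd_iff] at h ⊢
    grind
  by_cases c1 : a' = a ∨ a' = b ∨ a' = x
  -- As `q'` is not a neighbour, $b'$ lies outside $\{a,b,x\}$ and occurs once.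
  · refine ⟨b', key _ ?_⟩
    simp only [List.count_cons, List.count_nil, Nat.odd_iff]
    grind
  by_cases c2 : x' = a'
  · by_cases c3 : b' = a ∨ b' = b ∨ b' = x
    -- The pair $x'=a'$ has cancelled, leaving $x,a,b,b'$. If also $x=a$, only $b$ and $b'$ remain,
    -- and `h6` excludes $b=b'$. Otherwise $x,a,b$ are distinct and $b'$ can match only one of them.
    · by_cases c4 : x = a
      · refine ⟨b, key _ ?_⟩
        simp only [List.count_cons, List.count_nil, Nat.odd_iff]
        grind
      · by_cases c5 : b' = a
        · refine ⟨b, key _ ?_⟩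
          simp only [List.count_cons, List.count_nil, Nat.odd_iff]
          grind
        · refine ⟨a, key _ ?_⟩
          simp only [List.count_cons, List.count_nil, Nat.odd_iff]
          grind
    · refine ⟨b', key _ ?_⟩
      simp only [List.count_cons, List.count_nil, Nat.odd_iff]
      grind
  -- Here $a'$ differs from $x'$, $b'$ and all letters of `q`, so it occurs once.
  · refine ⟨a', key _ ?_⟩
    simp only [List.count_cons, List.count_nil, Nat.odd_iff]
    grind

theorem IsBernoulliFamily.integral_signProd_mul_eq_zero (hh : IsBernoulliFamily p h) {η : Freq}
    {q q' : Freq × Freq} (hq : ¬ IsResonant η q) (hq' : ¬ IsResonant η q')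
    (hn : q' ∉ collisionNeighbours η q) :
    ∫ ω, signProd h η q ω * signProd h η q' ω ∂p = 0 := by
  obtain ⟨ζ, hζ⟩ := exists_odd_count hq hq' hn
  rw [← hh.integral_prod_eq_zero hζ]
  refine integral_congr_ae (Eventually.of_forall fun ω => ?_)
  simp only [signProd, List.map_cons, List.map_nil, List.prod_cons, List.prod_nil]
  ring

end Bernoulli

/-! ### Functions of the tail of the random parameter -/

section Tail

/-- The σ-algebra on `Ω*` generated by the components `ω_ℓ` with `ℓ > k`. -/
@[reducible]
def tailAlgebra (Ω : Type u) [MeasurableSpace Ω] (k : ℕ) : MeasurableSpace (OmegaStar Ω) :=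
  ⨆ ℓ ∈ {ℓ : {ℓ : ℕ // 2 ≤ ℓ} | k < ℓ.1},
    MeasurableSpace.comap (fun ω : OmegaStar Ω => ω ℓ) inferInstance

variable {Ω : Type u} [MeasurableSpace Ω]

theorem tailAlgebra_le (k : ℕ) : tailAlgebra Ω k ≤ MeasurableSpace.pi :=
  iSup₂_le fun ℓ _ => (measurable_pi_apply ℓ).comap_le

instance (k : ℕ) : Fact (tailAlgebra Ω k ≤ MeasurableSpace.pi) := ⟨tailAlgebra_le k⟩

theorem tailAlgebra_anti {k l : ℕ} (hkl : k ≤ l) : tailAlgebra Ω l ≤ tailAlgebra Ω k :=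
  biSup_mono fun _ h => lt_of_le_of_lt hkl h

theorem measurable_tailAlgebra_eval {k : ℕ} {ℓ : {ℓ : ℕ // 2 ≤ ℓ}} (hℓ : k < ℓ.1) :
    Measurable[tailAlgebra Ω k] fun ω : OmegaStar Ω => ω ℓ := by
  rw [measurable_iff_comap_le]
  exact le_iSup₂_of_le ℓ hℓ le_rfl

variable (p : Measure Ω) [IsProbabilityMeasure p]

theorem indep_eval_tailAlgebra (ℓ : {ℓ : ℕ // 2 ≤ ℓ}) :
    ProbabilityTheory.Indep
      (MeasurableSpace.comap (fun ω : OmegaStar Ω => ω ℓ) inferInstance) (tailAlgebra Ω ℓ.1)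
      (starMeasure p) := by
  have h := ProbabilityTheory.iIndepFun_infinitePi (P := fun _ : {ℓ : ℕ // 2 ≤ ℓ} => p)
    (X := fun _ ω => ω) fun _ => measurable_id
  have h2 := ProbabilityTheory.indep_iSup_of_disjoint
    (fun ℓ => (measurable_pi_apply ℓ).comap_le) h (S := {ℓ}) (T := {ℓ' | ℓ.1 < ℓ'.1})
    (by simp)
  rw [iSup_singleton] at h2
  exact h2

/-- The space of the square integrable functions of the components `ω_ℓ` with `ℓ > k`. -/
abbrev TailL2 (k : ℕ) : Type u := lpMeas ℂ ℂ (tailAlgebra Ω k) 2 (starMeasure p)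

variable {p}

/-- A function of $\omega_\ell$ is independent of functions of later components, so the expectation
factors and the mean-zero factor kills it. -/
theorem integral_mul_inner_eq_zero {k : ℕ} {ℓ : {ℓ : ℕ // 2 ≤ ℓ}} (hℓ : ℓ.1 ≤ k)
    {g : Ω → ℝ} (hg : Measurable g)
    (hg0 : ∫ ω, g ω ∂p = 0) {c c' : OmegaStar Ω → ℂ}
    (hc : AEStronglyMeasurable[tailAlgebra Ω k] c (starMeasure p))
    (hc' : AEStronglyMeasurable[tailAlgebra Ω k] c' (starMeasure p)) :
    ∫ ω, (g (ω ℓ) : ℂ) * inner ℂ (c ω) (c' ω) ∂(starMeasure p) = 0 := by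
  -- Independence needs representatives that are genuinely measurable for the tail algebra.
  obtain ⟨d, hd, hcd⟩ := hc
  obtain ⟨d', hd', hcd'⟩ := hc'
  have hm : Measurable[tailAlgebra Ω k] fun ω => inner ℂ (d ω) (d' ω) :=
    (hd.inner hd').measurable
  have hG : Measurable fun x : Ω => (g x : ℂ) := Complex.measurable_ofReal.comp hg
  have hind : ProbabilityTheory.IndepFun (fun ω : OmegaStar Ω => (g (ω ℓ) : ℂ))
      (fun ω => inner ℂ (d ω) (d' ω)) (starMeasure p) := by
    rw [ProbabilityTheory.IndepFun_iff_Indep]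
    refine ProbabilityTheory.indep_of_indep_of_le_right
      (ProbabilityTheory.indep_of_indep_of_le_left (indep_eval_tailAlgebra p ℓ) ?_) 
      (hm.comap_le.trans (tailAlgebra_anti hℓ))
    rw [← measurable_iff_comap_le]
    exact hG.comp (comap_measurable _)
  have e : (fun ω => (g (ω ℓ) : ℂ) * inner ℂ (c ω) (c' ω)) =ᵐ[starMeasure p]
      fun ω => (g (ω ℓ) : ℂ) * inner ℂ (d ω) (d' ω) := by
    filter_upwards [hcd, hcd'] with ω h1 h2
    rw [h1, h2]
  have e0 : ∫ ω, (g (ω ℓ) : ℂ) ∂(starMeasure p) = 0 := by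
    rw [integral_complex_ofReal, Complex.ofReal_eq_zero, ← hg0]
    have hmp := measurePreserving_eval_infinitePi (fun _ : {ℓ : ℕ // 2 ≤ ℓ} => p) ℓ
    conv_rhs => rw [← hmp.map_eq]
    rw [integral_map hmp.measurable.aemeasurable hg.aestronglyMeasurable]
  rw [integral_congr_ae e, hind.integral_fun_mul_eq_mul_integral
    (hG.comp (measurable_pi_apply ℓ)).aestronglyMeasurable
    (hm.mono (tailAlgebra_le _) le_rfl).aestronglyMeasurable, e0, zero_mul]

variable {h : Freq → Ω → ℝ}

theorem ae_norm_signProd_eval (hh : IsBernoulliFamily p h) (ℓ : {ℓ : ℕ // 2 ≤ ℓ}) (η : Freq)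
    (q : Freq × Freq) :
    ∀ᵐ ω ∂(starMeasure p), ‖((signProd h η q (ω ℓ) : ℝ) : ℂ)‖ = 1 := by
  have hmp := measurePreserving_eval_infinitePi (fun _ : {ℓ : ℕ // 2 ≤ ℓ} => p) ℓ
  filter_upwards [hmp.quasiMeasurePreserving.ae (hh.ae_abs_signProd η q)] with ω hω
  rw [Complex.norm_real]
  exact hω

theorem measurable_signProd_eval (hh : IsBernoulliFamily p h) {k : ℕ} {ℓ : {ℓ : ℕ // 2 ≤ ℓ}}
    (hℓ : k < ℓ.1) (η : Freq) (q : Freq × Freq) :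
    Measurable[tailAlgebra Ω k] fun ω : OmegaStar Ω => ((signProd h η q (ω ℓ) : ℝ) : ℂ) :=
  Complex.measurable_ofReal.comp
    ((hh.measurable_signProd η q).comp (measurable_tailAlgebra_eval hℓ))

/-- The multiplication by the signs of the term `q` of the collision operator, evaluated at
`ω_ℓ`. -/
def signMulLp (hh : IsBernoulliFamily p h) (ℓ : {ℓ : ℕ // 2 ≤ ℓ}) (η : Freq) (q : Freq × Freq) :
    Lp ℂ 2 (starMeasure p) →ₗᵢ[ℂ] Lp ℂ 2 (starMeasure p) :=
  unimodularMulLp (fun ω : OmegaStar Ω => ((signProd h η q (ω ℓ) : ℝ) : ℂ))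
    (Complex.measurable_ofReal.comp
      ((hh.measurable_signProd η q).comp (measurable_pi_apply ℓ))).aestronglyMeasurable
    (ae_norm_signProd_eval hh ℓ η q)

theorem coeFn_signMulLp (hh : IsBernoulliFamily p h) (ℓ : {ℓ : ℕ // 2 ≤ ℓ}) (η : Freq)
    (q : Freq × Freq) (c : Lp ℂ 2 (starMeasure p)) :
    signMulLp hh ℓ η q c =ᵐ[starMeasure p]
      fun ω => ((signProd h η q (ω ℓ) : ℝ) : ℂ) * c ω :=
  coeFn_unimodularMulLp _ _ _

/-- The signs bring in $\omega_{k+1}$ and nothing else, so the tail grows by exactly one component.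
-/
theorem signMulLp_mem (hh : IsBernoulliFamily p h) {k : ℕ} {ℓ : {ℓ : ℕ // 2 ≤ ℓ}}
    (hℓ : ℓ.1 = k + 1) (η : Freq) (q : Freq × Freq) (c : TailL2 p (k + 1)) :
    signMulLp hh ℓ η q c ∈ lpMeas ℂ ℂ (tailAlgebra Ω k) 2 (starMeasure p) := by
  refine mem_lpMeas_iff_aestronglyMeasurable.2 ?_
  refine AEStronglyMeasurable.congr ?_ (coeFn_signMulLp hh ℓ η q c).symm
  refine AEStronglyMeasurable.mul ?_ ?_
  · exact (measurable_signProd_eval hh (by omega) η q).stronglyMeasurable.aestronglyMeasurable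
  · exact (lpMeas.aestronglyMeasurable c).mono (tailAlgebra_anti (Nat.le_succ k))

/-- The multiplication by the signs of the term `q` of the collision operator, evaluated at
`ω_{k+1}`, between spaces of functions of the tail of `ω*`. -/
def signMul (hh : IsBernoulliFamily p h) {k : ℕ} {ℓ : {ℓ : ℕ // 2 ≤ ℓ}} (hℓ : ℓ.1 = k + 1)
    (η : Freq) (q : Freq × Freq) : TailL2 p (k + 1) →L[ℂ] TailL2 p k :=
  ((signMulLp hh ℓ η q).toContinuousLinearMap.comp (Submodule.subtypeL _)).codRestrict _
    (signMulLp_mem hh hℓ η q)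

theorem coe_signMul (hh : IsBernoulliFamily p h) {k : ℕ} {ℓ : {ℓ : ℕ // 2 ≤ ℓ}}
    (hℓ : ℓ.1 = k + 1) (η : Freq) (q : Freq × Freq) (c : TailL2 p (k + 1)) :
    (signMul hh hℓ η q c : Lp ℂ 2 (starMeasure p)) = signMulLp hh ℓ η q c := rfl

/-- The probabilistic core: the product of the two sign factors depends on $\omega_{k+1}$ alone and
has mean zero, while `c` and `c'` depend only on later components. -/
theorem isSignFamily_signMul (hh : IsBernoulliFamily p h) {k : ℕ} {ℓ : {ℓ : ℕ // 2 ≤ ℓ}}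
    (hℓ : ℓ.1 = k + 1) : IsSignFamily (signMul (k := k) hh hℓ) where
  norm_le η q c := ((signMulLp hh ℓ η q).norm_map _).le
  inner_eq_zero η q q' c c' hq hq' hn := by
    rw [Submodule.coe_inner, coe_signMul, coe_signMul, L2.inner_def]
    have hint := hh.integral_signProd_mul_eq_zero hq hq' hn
    rw [← integral_mul_inner_eq_zero hℓ.le
      ((hh.measurable_signProd η q).mul (hh.measurable_signProd η q')) hint
      (lpMeas.aestronglyMeasurable c) (lpMeas.aestronglyMeasurable c')]
    refine integral_congr_ae ?_
    filter_upwards [coeFn_signMulLp hh ℓ η q c, coeFn_signMulLp hh ℓ η q' c'] with ω h1 h2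
    rw [h1, h2]
    simp only [RCLike.inner_apply, map_mul, Complex.conj_ofReal, Pi.mul_apply]
    push_cast
    ring

end Tail

/-- Used with `π` a Fourier coefficient, to read off the coefficients of a synthesized density
matrix. -/
theorem map_linearIsometry_of_forall_ne {ι A E F : Type*} [NormedAddCommGroup A]
    [InnerProductSpace ℂ A] [NormedAddCommGroup E] [InnerProductSpace ℂ E] [CompleteSpace E]
    [NormedAddCommGroup F] [NormedSpace ℂ F] {V : ι → A →ₗᵢ[ℂ] E}
    (hV : OrthogonalFamily ℂ (fun _ : ι => A) V) (π : E →L[ℂ] F) {i : ι}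
    (h : ∀ j, j ≠ i → ∀ x, π (V j x) = 0) (w : lp (fun _ : ι => A) 2) :
    π (hV.linearIsometry w) = π (V i (w i)) :=
  (π.hasSum (hV.hasSum_linearIsometry w)).unique (hasSum_single i fun j hj => h j hj _)

/-! ### Fourier coefficients of random density matrices -/

/-- The frequencies `(ξ; ξ')` of density matrices of order `k`. -/
abbrev FreqPair (k : ℕ) : Type := (Fin k → Freq) × (Fin k → Freq)

theorem freqVec_injective {k : ℕ} : Function.Injective fun q : FreqPair k => freqVec q.1 q.2 := by
  rintro ⟨a, b⟩ ⟨c, d⟩ h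
  refine Prod.ext (funext fun j => funext fun i => ?_) (funext fun j => funext fun i => ?_)
  · exact congrFun h (Sum.inl (j, i))
  · exact neg_injective (congrFun h (Sum.inr (j, i)))

theorem freqVec_surjective {k : ℕ} :
    Function.Surjective fun q : FreqPair k => freqVec q.1 q.2 := fun n => by
  refine ⟨(fun j i => n (Sum.inl (j, i)), fun j i => - n (Sum.inr (j, i))), ?_⟩
  ext (x | x) <;> simp [freqVec]

/-- The character with frequencies `(ξ; ξ')`, as an element of `L²(Λᵏ × Λᵏ)`. -/
def charVec {k : ℕ} (q : FreqPair k) : DensityMatrix k := characterBasis k (freqVec q.1 q.2)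

theorem inner_charVec {k : ℕ} (q : FreqPair k) (σ : DensityMatrix k) :
    inner ℂ (charVec q) σ = fourierCoeff σ q.1 q.2 := by
  rw [← characterBasis_repr, HilbertBasis.repr_apply_apply, charVec]

theorem inner_charVec_charVec {k : ℕ} (q q' : FreqPair k) :
    inner ℂ (charVec q) (charVec q') = if q = q' then (1 : ℂ) else 0 := by
  classical
  rw [charVec, charVec, orthonormal_iff_ite.1 (characterBasis k).orthonormal]
  simp only [freqVec_injective.eq_iff' (a := q) (b := q') rfl]

theorem norm_charVec {k : ℕ} (q : FreqPair k) : ‖charVec q‖ = 1 :=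
  (characterBasis k).orthonormal.1 _

theorem eq_of_fourierCoeff_eq {k : ℕ} {σ τ : DensityMatrix k}
    (h : ∀ q : FreqPair k, fourierCoeff σ q.1 q.2 = fourierCoeff τ q.1 q.2) : σ = τ := by
  refine (characterBasis k).repr.injective (lp.ext (funext fun n => ?_))
  obtain ⟨q, rfl⟩ := freqVec_surjective n
  simp only [characterBasis_repr, h q]

section Random

variable {Ω : Type u} [MeasurableSpace Ω] {p : Measure Ω} [IsProbabilityMeasure p] {k : ℕ}

/-- The Fourier coefficient at `(ξ; ξ')` of a random density matrix. -/
def coeffLp (q : FreqPair k) : RandomDM p k →L[ℂ] Lp ℂ 2 (starMeasure p) :=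
  (innerSL ℂ (charVec q)).compLpL 2 (starMeasure p)

theorem coeFn_coeffLp (q : FreqPair k) (σ : RandomDM p k) :
    coeffLp q σ =ᵐ[starMeasure p] fun ω => fourierCoeff (σ ω) q.1 q.2 := by
  filter_upwards [(innerSL ℂ (charVec q)).coeFn_compLpL σ] with ω hω
  rw [coeffLp, hω, innerSL_apply_apply, inner_charVec]

theorem ext_coeffLp {σ τ : RandomDM p k} (h : ∀ q : FreqPair k, coeffLp q σ = coeffLp q τ) :
    σ = τ := by
  refine Lp.ext ?_
  -- There are countably many frequencies, so one null set serves for all.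
  have : ∀ᵐ ω ∂(starMeasure p), ∀ q : FreqPair k,
      fourierCoeff (σ ω) q.1 q.2 = fourierCoeff (τ ω) q.1 q.2 := by
    rw [ae_all_iff]
    intro q
    filter_upwards [coeFn_coeffLp q σ, coeFn_coeffLp q τ] with ω h1 h2
    rw [← h1, ← h2, h q]
  filter_upwards [this] with ω hω
  exact eq_of_fourierCoeff_eq hω

/-- The random density matrix with a single nonzero Fourier coefficient. -/
def charEmbed (q : FreqPair k) : Lp ℂ 2 (starMeasure p) →ₗᵢ[ℂ] RandomDM p k where
  toLinearMap := ((ContinuousLinearMap.toSpanSingleton ℂ (charVec q)).compLpL 2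
    (starMeasure p)).toLinearMap
  norm_map' f := by
    change ‖(ContinuousLinearMap.toSpanSingleton ℂ (charVec q)).compLpL 2 (starMeasure p) f‖ = _
    rw [Lp.norm_def, Lp.norm_def]
    congr 1
    refine eLpNorm_congr_norm_ae ?_
    filter_upwards [(ContinuousLinearMap.toSpanSingleton ℂ (charVec q)).coeFn_compLpL f]
      with ω hω
    rw [hω, ContinuousLinearMap.toSpanSingleton_apply, norm_smul, norm_charVec, mul_one]

theorem coeFn_charEmbed (q : FreqPair k) (f : Lp ℂ 2 (starMeasure p)) :
    charEmbed q f =ᵐ[starMeasure p] fun ω => f ω • charVec q :=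
  (ContinuousLinearMap.toSpanSingleton ℂ (charVec q)).coeFn_compLpL f

theorem coeffLp_charEmbed_self (q : FreqPair k) (f : Lp ℂ 2 (starMeasure p)) :
    coeffLp q (charEmbed q f) = f := by
  refine Lp.ext ?_
  filter_upwards [coeFn_coeffLp q (charEmbed q f), coeFn_charEmbed q f] with ω h1 h2
  rw [h1, h2, ← inner_charVec, inner_smul_right, inner_charVec_charVec, if_pos rfl, mul_one]

theorem coeffLp_charEmbed_ne {q q' : FreqPair k} (h : q ≠ q') (f : Lp ℂ 2 (starMeasure p)) :
    coeffLp q (charEmbed q' f) = 0 := by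
  refine Lp.ext ?_
  filter_upwards [coeFn_coeffLp q (charEmbed q' f), coeFn_charEmbed q' f,
    Lp.coeFn_zero ℂ 2 (starMeasure p)] with ω h1 h2 h3
  rw [h1, h2, ← inner_charVec, inner_smul_right, inner_charVec_charVec, if_neg h, mul_zero, h3]
  rfl

/-- The restriction of `charEmbed q` to the functions of the tail of `ω*`. -/
def tailEmbed (q : FreqPair k) : TailL2 p k →ₗᵢ[ℂ] RandomDM p k :=
  (charEmbed q).comp (lpMeas ℂ ℂ (tailAlgebra Ω k) 2 (starMeasure p)).subtypeₗᵢ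

theorem tailEmbed_apply (q : FreqPair k) (f : TailL2 p k) :
    tailEmbed q f = charEmbed q (f : Lp ℂ 2 (starMeasure p)) := rfl

variable (p k) in
theorem orthogonalFamily_tailEmbed :
    OrthogonalFamily ℂ (fun _ : FreqPair k => TailL2 p k) tailEmbed := by
  intro q q' hqq f g
  rw [tailEmbed_apply, tailEmbed_apply, L2.inner_def]
  refine integral_eq_zero_of_ae ?_
  filter_upwards [coeFn_charEmbed q (f : Lp ℂ 2 (starMeasure p)),
    coeFn_charEmbed q' (g : Lp ℂ 2 (starMeasure p))] with ω h1 h2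
  rw [h1, h2, inner_smul_left, inner_smul_right, inner_charVec_charVec, if_neg hqq, mul_zero,
    mul_zero]
  rfl

/-! ### The model space -/

variable (p k) in
/-- The space of the weighted Fourier coefficients of the elements of `L²(Ω*) H^α(Λᵏ × Λᵏ)` that
depend only on the components `ω_ℓ` with `ℓ > k`. -/
abbrev ModelSpace : Type u := lp (fun _ : FreqPair k => TailL2 p k) 2

theorem sobolevWeight_pos (α : ℝ) (ξ ξ' : Fin k → Freq) : 0 < sobolevWeight α ξ ξ' :=
  mul_pos (Finset.prod_pos fun _ _ => Real.rpow_pos_of_pos (japaneseBracket_pos _) _)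
    (Finset.prod_pos fun _ _ => Real.rpow_pos_of_pos (japaneseBracket_pos _) _)

theorem one_le_sobolevWeight {α : ℝ} (hα : 0 ≤ α) (ξ ξ' : Fin k → Freq) :
    1 ≤ sobolevWeight α ξ ξ' := by
  have h : ∀ ζ : Fin k → Freq, 1 ≤ ∏ j, japaneseBracket (ζ j) ^ α := fun ζ =>
    Finset.prod_induction _ (fun x : ℝ => 1 ≤ x) (fun _ _ => one_le_mul_of_one_le_of_one_le)
      le_rfl fun j _ => Real.one_le_rpow (one_le_japaneseBracket _) hα
  exact one_le_mul_of_one_le_of_one_le (h ξ) (h ξ')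

/-- For $\alpha\ge0$, removing the weight is a contraction; this is the embedding of $H^\alpha$ into
$L^2$. -/
theorem norm_inv_sobolevWeight_le {α : ℝ} (hα : 0 ≤ α) (q : FreqPair k) :
    ‖((sobolevWeight α q.1 q.2 : ℝ) : ℂ)⁻¹‖ ≤ 1 := by
  rw [norm_inv, Complex.norm_of_nonneg (sobolevWeight_pos _ _ _).le]
  exact inv_le_one_of_one_le₀ (one_le_sobolevWeight hα _ _)

/-- The random density matrix with given weighted Fourier coefficients. -/
def synth {α : ℝ} (hα : 0 ≤ α) : ModelSpace p k →L[ℂ] RandomDM p k :=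
  (orthogonalFamily_tailEmbed p k).linearIsometry.toContinuousLinearMap.comp
    (diagMul (fun q => ((sobolevWeight α q.1 q.2 : ℝ) : ℂ)⁻¹) (norm_inv_sobolevWeight_le hα))

variable {α : ℝ} (hα : 0 ≤ α)

theorem coeffLp_synth (v : ModelSpace p k) (q : FreqPair k) :
    coeffLp q (synth hα v) =
      ((sobolevWeight α q.1 q.2 : ℝ) : ℂ)⁻¹ • (v q : Lp ℂ 2 (starMeasure p)) := by
  refine (map_linearIsometry_of_forall_ne (orthogonalFamily_tailEmbed p k) (coeffLp q)
    (fun q' hq' f => coeffLp_charEmbed_ne hq'.symm _) _).trans ?_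
  rw [tailEmbed_apply, coeffLp_charEmbed_self]
  rfl

theorem coeFn_fourierCoeff_synth (v : ModelSpace p k) (q : FreqPair k) :
    (fun ω => fourierCoeff (synth hα v ω) q.1 q.2) =ᵐ[starMeasure p]
      fun ω => ((sobolevWeight α q.1 q.2 : ℝ) : ℂ)⁻¹ * (v q : Lp ℂ 2 (starMeasure p)) ω := by
  have h1 := coeFn_coeffLp q (synth hα v)
  rw [coeffLp_synth] at h1
  filter_upwards [h1, Lp.coeFn_smul ((sobolevWeight α q.1 q.2 : ℝ) : ℂ)⁻¹
    (v q : Lp ℂ 2 (starMeasure p))] with ω h1 h2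
  rw [← h1, h2]
  rfl

theorem enorm_sq_eq_tsum (v : ModelSpace p k) : ‖v‖ₑ ^ 2 = ∑' q, ‖v q‖ₑ ^ 2 := by
  have h := ENNReal.ofReal_tsum_of_nonneg (fun q => sq_nonneg ‖v q‖) (summable_norm_sq v)
  rw [← lp_norm_sq] at h
  simpa only [ENNReal.ofReal_pow (norm_nonneg _), ofReal_norm] using h

theorem Lp_enorm_sq_eq_lintegral {X : Type*} [MeasurableSpace X] {μ : Measure X}
    (f : Lp ℂ 2 μ) : ‖f‖ₑ ^ 2 = ∫⁻ x, ‖f x‖ₑ ^ 2 ∂μ := by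
  rw [Lp.enorm_def, eLpNorm_eq_lintegral_rpow_enorm_toReal (by norm_num) (by norm_num)]
  simp only [ENNReal.toReal_ofNat, ENNReal.rpow_ofNat, one_div]
  rw [← ENNReal.rpow_natCast, ← ENNReal.rpow_mul]
  norm_num

theorem rpow_half_sq (x : ℝ≥0∞) : (x ^ (1 / 2 : ℝ)) ^ 2 = x := by
  rw [← ENNReal.rpow_natCast, ← ENNReal.rpow_mul]
  norm_num

theorem sq_rpow_half (x : ℝ≥0∞) : (x ^ 2) ^ (1 / 2 : ℝ) = x := by
  rw [← ENNReal.rpow_natCast, ← ENNReal.rpow_mul]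
  norm_num

/-- Tonelli exchanges the expectation with the sum over frequencies, after the weights have
cancelled. -/
theorem randomSobolevNorm_synth (v : ModelSpace p k) :
    randomSobolevNorm α (synth hα v) = ‖v‖ₑ := by
  have hae : ∀ᵐ ω ∂(starMeasure p), ∀ q : FreqPair k, fourierCoeff (synth hα v ω) q.1 q.2 =
      ((sobolevWeight α q.1 q.2 : ℝ) : ℂ)⁻¹ * (v q : Lp ℂ 2 (starMeasure p)) ω :=
    ae_all_iff.2 fun q => coeFn_fourierCoeff_synth hα v q
  have h1 : ∫⁻ ω, sobolevNorm α (synth hα v ω) ^ 2 ∂(starMeasure p) =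
      ∫⁻ ω, ∑' q : FreqPair k, ‖(v q : Lp ℂ 2 (starMeasure p)) ω‖ₑ ^ 2 ∂(starMeasure p) := by
    refine lintegral_congr_ae ?_
    filter_upwards [hae] with ω hω
    rw [sobolevNorm, rpow_half_sq]
    refine tsum_congr fun q => ?_
    have hw : ((sobolevWeight α q.1 q.2 : ℝ) : ℂ) ≠ 0 :=
      Complex.ofReal_ne_zero.2 (sobolevWeight_pos _ _ _).ne'
    rw [hω q, mul_inv_cancel_left₀ hw]
  rw [randomSobolevNorm, h1, lintegral_tsum fun q =>
    ((Lp.aestronglyMeasurable (v q : Lp ℂ 2 (starMeasure p))).enorm.pow_const 2)]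
  rw [tsum_congr fun q => (Lp_enorm_sq_eq_lintegral (v q : Lp ℂ 2 (starMeasure p))).symm]
  rw [← sq_rpow_half ‖v‖ₑ, enorm_sq_eq_tsum]
  rfl

/-- The weighted Fourier coefficients of a deterministic density matrix. -/
theorem exists_synth_eq_constRandom {σ : DensityMatrix k} (hσ : sobolevNorm α σ < ∞) :
    ∃ v : ModelSpace p k, synth hα v = constRandom p σ ∧ ‖v‖ₑ = sobolevNorm α σ := by
  set c : FreqPair k → ℂ := fun q => (sobolevWeight α q.1 q.2 : ℂ) * fourierCoeff σ q.1 q.2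
  have hmem : ∀ q, Lp.const 2 (starMeasure p) (c q) ∈
      lpMeas ℂ ℂ (tailAlgebra Ω k) 2 (starMeasure p) := fun q =>
    mem_lpMeas_iff_aestronglyMeasurable.2
      (AEStronglyMeasurable.congr
        (stronglyMeasurable_const (b := c q)).aestronglyMeasurable
        (Lp.coeFn_const 2 (starMeasure p) (c q)).symm)
  have hnorm : ∀ q, ‖(⟨_, hmem q⟩ : TailL2 p k)‖ = ‖c q‖ := fun q => by
    change ‖Lp.const 2 (starMeasure p) (c q)‖ = _
    rw [Lp.norm_const' _ _ _ (by norm_num) (by norm_num)]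
    simp
  have hsq : ∑' q, ‖c q‖ₑ ^ 2 = sobolevNorm α σ ^ 2 := (rpow_half_sq _).symm
  have hsum : Summable fun q => ‖c q‖ ^ 2 := by
    have hfin : ∑' q, ‖c q‖ₑ ^ 2 ≠ ∞ := by
      rw [hsq]
      exact ENNReal.pow_ne_top hσ.ne
    refine (ENNReal.summable_toReal hfin).congr fun q => ?_
    simp
  set v : ModelSpace p k := ⟨fun q => ⟨_, hmem q⟩, memℓp_two_iff.2 (by
    simpa only [hnorm] using hsum)⟩ with hv
  refine ⟨v, ext_coeffLp fun q => ?_, ?_⟩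
  · rw [coeffLp_synth]
    refine Lp.ext ?_
    filter_upwards [coeFn_coeffLp q (constRandom p σ), Lp.coeFn_const 2 (starMeasure p) σ,
      Lp.coeFn_const 2 (starMeasure p) (c q), Lp.coeFn_smul
      ((sobolevWeight α q.1 q.2 : ℝ) : ℂ)⁻¹ (v q : Lp ℂ 2 (starMeasure p))] with ω h1 h2 h3 h4
    have hw : ((sobolevWeight α q.1 q.2 : ℝ) : ℂ) ≠ 0 :=
      Complex.ofReal_ne_zero.2 (sobolevWeight_pos _ _ _).ne'
    rw [h4, h1, constRandom, h2]
    change _ * (Lp.const 2 (starMeasure p) (c q)) ω = _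
    rw [h3]
    exact inv_mul_cancel_left₀ hw _
  · rw [← sq_rpow_half ‖v‖ₑ, ← sq_rpow_half (sobolevNorm α σ), enorm_sq_eq_tsum, ← hsq]
    congr 1
    refine tsum_congr fun q => ?_
    rw [← ofReal_norm, ← ofReal_norm]
    congr 2
    exact hnorm q

/-! ### The free evolution on the model space -/

/-- The free evolution on the model space. -/
def modelEvolution (t : ℝ) : ModelSpace p k →L[ℂ] ModelSpace p k :=
  diagMul (fun q => freeSymbol k t (freqVec q.1 q.2)) fun _ => (norm_freeSymbol k t _).le

theorem norm_modelEvolution (t : ℝ) (v : ModelSpace p k) : ‖modelEvolution t v‖ = ‖v‖ :=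
  norm_diagMul_of_norm_eq_one (fun _ => norm_freeSymbol k t _) v

theorem freeEvolutionR_synth (t : ℝ) (v : ModelSpace p k) :
    freeEvolutionR k t (synth hα v) = synth hα (modelEvolution t v) := by
  refine ext_coeffLp fun q => ?_
  rw [coeffLp_synth]
  refine Lp.ext ?_
  filter_upwards [coeFn_coeffLp q (freeEvolutionR k t (synth hα v)),
    (freeEvolution k t).coeFn_compLp (synth hα v), coeFn_fourierCoeff_synth hα v q,
    Lp.coeFn_smul ((sobolevWeight α q.1 q.2 : ℝ) : ℂ)⁻¹
      (modelEvolution t v q : Lp ℂ 2 (starMeasure p)),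
    Lp.coeFn_smul (freeSymbol k t (freqVec q.1 q.2))
      (v q : Lp ℂ 2 (starMeasure p))] with ω h1 h2 h3 h4 h5
  rw [h1, freeEvolutionR, h2, fourierCoeff_freeEvolution, h3, h4]
  change _ = _ * (freeSymbol k t (freqVec q.1 q.2) • (v q : Lp ℂ 2 (starMeasure p)) :
    Lp ℂ 2 (starMeasure p)) ω
  rw [h5, Pi.smul_apply, smul_eq_mul]
  ring

theorem freeSymbol_add (s t : ℝ) (n : Coord k → ℤ) :
    freeSymbol k (s + t) n = freeSymbol k s n * freeSymbol k t n := by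
  rw [freeSymbol, freeSymbol, freeSymbol, ← Complex.exp_add]
  congr 1
  push_cast
  ring

theorem modelEvolution_add (s t : ℝ) (v : ModelSpace p k) :
    modelEvolution (s + t) v = modelEvolution s (modelEvolution t v) := by
  ext q : 2
  change freeSymbol k (s + t) _ • v q = freeSymbol k s _ • freeSymbol k t _ • v q
  rw [freeSymbol_add, mul_smul]

theorem continuous_modelEvolution (v : ModelSpace p k) :
    Continuous fun t => modelEvolution t v :=
  continuous_diagMul _ (fun q => by unfold freeSymbol; fun_prop) v

/-- Joint continuity follows from strong continuity at `v₀`, since the evolution of `v - v₀` has the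
norm of `v - v₀` at all times. -/
theorem continuous_modelEvolution_uncurry :
    Continuous fun x : ℝ × ModelSpace p k => modelEvolution x.1 x.2 := by
  rw [continuous_iff_continuousAt]
  rintro ⟨t₀, v₀⟩
  have h1 : Tendsto (fun x : ℝ × ModelSpace p k => modelEvolution x.1 (x.2 - v₀)) (𝓝 (t₀, v₀))
      (𝓝 0) := by
    rw [tendsto_zero_iff_norm_tendsto_zero]
    simp only [norm_modelEvolution]
    exact tendsto_iff_norm_sub_tendsto_zero.1 (continuous_snd.tendsto (t₀, v₀))
  have h2 := ((continuous_modelEvolution v₀).comp continuous_fst).tendsto (t₀, v₀)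
  have h3 := h1.add h2
  simp only [Function.comp, map_sub, sub_add_cancel, zero_add] at h3
  exact h3

end Random

/-! ### The frequencies of the terms of the collision operators -/

section Frequencies

variable {k : ℕ} (j : Fin k)

theorem mul_prod_update (f : Freq → ℝ) (ξ : Fin k → Freq) (x : Freq) :
    f (ξ j) * ∏ i, f (Function.update ξ j x i) = (∏ i, f (ξ i)) * f x := by
  rw [← Finset.mul_prod_erase Finset.univ _ (Finset.mem_univ j),
    ← Finset.mul_prod_erase Finset.univ (fun i => f (ξ i)) (Finset.mem_univ j),
    Function.update_self, Finset.prod_congr rfl fun i hi => by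
      rw [Function.update_of_ne (Finset.ne_of_mem_erase hi)]]
  ring

theorem prod_snoc (f : Freq → ℝ) (ξ : Fin k → Freq) (a : Freq) :
    ∏ i, f (Fin.snoc (α := fun _ => Freq) ξ a i) = (∏ i, f (ξ i)) * f a := by
  rw [Fin.prod_univ_castSucc]
  simp only [Fin.snoc_castSucc, Fin.snoc_last]

/-- The last entry gives $a$; once $b$ is known from the other group of variables, the shift by
$-a+b$ can be undone. -/
theorem snoc_update_injective {ξ ζ : Fin k → Freq} {a b a' b' : Freq}
    (h : (Fin.snoc (α := fun _ => Freq) (Function.update ξ j (ξ j - a + b)) a : Fin (k + 1) → Freq)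
      = Fin.snoc (α := fun _ => Freq) (Function.update ζ j (ζ j - a' + b')) a') (hb : b = b') :
    ξ = ζ ∧ a = a' := by
  obtain ⟨h1, h2⟩ := Fin.snoc_injective2 h
  subst h2 hb
  refine ⟨funext fun i => ?_, rfl⟩
  have hi := congrFun h1 i
  by_cases hij : i = j
  · subst hij
    simpa using hi
  · simpa [Function.update_of_ne hij] using hi

/-- The frequencies of the term `(a, b)` of `B_{j,k+1}^+`. -/
def plusIndex (n : FreqPair k) (q : Freq × Freq) : FreqPair (k + 1) :=
  (Fin.snoc (α := fun _ => Freq) (Function.update n.1 j (n.1 j - q.1 + q.2)) q.1,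
    Fin.snoc (α := fun _ => Freq) n.2 q.2)

/-- The frequencies of the term `(b, a)` of `B_{j,k+1}^-`. -/
def minusIndex (n : FreqPair k) (q : Freq × Freq) : FreqPair (k + 1) :=
  (Fin.snoc (α := fun _ => Freq) n.1 q.2,
    Fin.snoc (α := fun _ => Freq) (Function.update n.2 j (n.2 j - q.1 + q.2)) q.1)

theorem plusIndex_injective : Function.Injective (Function.uncurry (plusIndex j)) := by
  rintro ⟨⟨ξ, ξ'⟩, a, b⟩ ⟨⟨ζ, ζ'⟩, c, d⟩ h
  obtain ⟨h1, h2⟩ := Prod.mk.inj h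
  obtain ⟨h3, h4⟩ := Fin.snoc_injective2 h2
  obtain ⟨h5, h6⟩ := snoc_update_injective j h1 h4
  simp only at h3 h4 h5 h6
  simp only [h3, h4, h5, h6]

theorem minusIndex_injective : Function.Injective (Function.uncurry (minusIndex j)) := by
  rintro ⟨⟨ξ, ξ'⟩, a, b⟩ ⟨⟨ζ, ζ'⟩, c, d⟩ h
  obtain ⟨h1, h2⟩ := Prod.mk.inj h
  obtain ⟨h3, h4⟩ := Fin.snoc_injective2 h1
  obtain ⟨h5, h6⟩ := snoc_update_injective j h2 h4
  simp only at h3 h4 h5 h6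
  simp only [h3, h4, h5, h6]

/-- The reason for the form of `weightRatio`: it is the output weight divided by the input weight,
all unaffected variables having cancelled. -/
theorem weightRatio_mul_sobolevWeight_plusIndex (α : ℝ) (n : FreqPair k) (q : Freq × Freq) :
    weightRatio α (n.1 j) q * sobolevWeight α (plusIndex j n q).1 (plusIndex j n q).2 =
      sobolevWeight α n.1 n.2 := by
  have h := fun ζ => (Real.rpow_pos_of_pos (japaneseBracket_pos ζ) α).ne'
  have e := mul_prod_update j (fun ζ => japaneseBracket ζ ^ α) n.1 (n.1 j - q.1 + q.2)
  simp only [sobolevWeight, plusIndex, prod_snoc (fun ζ => japaneseBracket ζ ^ α), weightRatio]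
  rw [div_mul_eq_mul_div, div_eq_iff (mul_ne_zero (mul_ne_zero (h _) (h _)) (h _))]
  linear_combination (japaneseBracket q.1 ^ α * (∏ i, japaneseBracket (n.2 i) ^ α) *
    japaneseBracket q.2 ^ α) * e

theorem weightRatio_mul_sobolevWeight_minusIndex (α : ℝ) (n : FreqPair k) (q : Freq × Freq) :
    weightRatio α (n.2 j) q * sobolevWeight α (minusIndex j n q).1 (minusIndex j n q).2 =
      sobolevWeight α n.1 n.2 := by
  have h := fun ζ => (Real.rpow_pos_of_pos (japaneseBracket_pos ζ) α).ne'
  have e := mul_prod_update j (fun ζ => japaneseBracket ζ ^ α) n.2 (n.2 j - q.1 + q.2)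
  simp only [sobolevWeight, minusIndex, prod_snoc (fun ζ => japaneseBracket ζ ^ α), weightRatio]
  rw [div_mul_eq_mul_div, div_eq_iff (mul_ne_zero (mul_ne_zero (h _) (h _)) (h _))]
  linear_combination (japaneseBracket q.1 ^ α * (∏ i, japaneseBracket (n.1 i) ^ α) *
    japaneseBracket q.2 ^ α) * e

end Frequencies

/-! ### The randomized collision operators on the model space -/

section Random

variable {Ω : Type u} [MeasurableSpace Ω] {p : Measure Ω} [IsProbabilityMeasure p] {k : ℕ}

/-- Turns the defining limits into unconditional sums in the Hilbert space $L^2(\Omega^*)$, which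
makes uniqueness of sums available. -/
theorem hasCollisionSum_iff {term : (Fin k → Freq) → (Fin k → Freq) → Freq → Freq →
    OmegaStar Ω → ℂ} {G : FreqPair k → Freq × Freq → Lp ℂ 2 (starMeasure p)}
    (hG : ∀ n q, G n q =ᵐ[starMeasure p] term n.1 n.2 q.1 q.2) (τ : RandomDM p k) :
    HasCollisionSum term τ ↔ ∀ n, HasSum (G n) (coeffLp n τ) := by
  have key : ∀ n (F : Finset (Freq × Freq)),
      eLpNorm (fun ω => fourierCoeff (τ ω) n.1 n.2 - ∑ q ∈ F, term n.1 n.2 q.1 q.2 ω) 2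
        (starMeasure p) = ‖coeffLp n τ - ∑ q ∈ F, G n q‖ₑ := fun n F => by
    rw [Lp.enorm_def]
    refine eLpNorm_congr_ae ?_
    have hsum : ∀ᵐ ω ∂(starMeasure p), ∀ q ∈ F, G n q ω = term n.1 n.2 q.1 q.2 ω :=
      (Finset.eventually_all F).2 fun q _ => hG n q
    filter_upwards [hsum, coeFn_coeffLp n τ, Lp.coeFn_sub (coeffLp n τ) (∑ q ∈ F, G n q),
      Lp.coeFn_finsetSum F (G n)] with ω h1 h2 h3 h4
    rw [h3, Pi.sub_apply, h4, h2, Finset.sum_apply, Finset.sum_congr rfl h1]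
  have key2 : ∀ n, HasSum (G n) (coeffLp n τ) ↔
      Tendsto (fun F => ‖coeffLp n τ - ∑ q ∈ F, G n q‖ₑ) atTop (𝓝 0) := fun n => by
    rw [HasSum, SummationFilter.unconditional_filter, tendsto_iff_edist_tendsto_0]
    simp only [edist_comm _ (coeffLp n τ), edist_eq_enorm_sub]
  constructor
  · intro H n
    rw [key2]
    simpa only [key] using H n.1 n.2
  · intro H ξ ξ'
    have := (key2 (ξ, ξ')).1 (H (ξ, ξ'))
    simpa only [← key] using this

variable {h : Freq → Ω → ℝ} {α : ℝ}

/-- The operator `[B_{j,k+1}^+]^{ω_{k+1}}` on the model space. -/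
def modelPlus (hh : IsBernoulliFamily p h) (hα : 3 / 4 < α) (j : Fin k) :
    ModelSpace p (k + 1) →L[ℂ] ModelSpace p k :=
  modelCollision (isSignFamily_signMul (ℓ := paramIndex j) hh rfl) hα (fun n => n.1 j)
    (plusIndex_injective j)

/-- The operator `[B_{j,k+1}^-]^{ω_{k+1}}` on the model space. -/
def modelMinus (hh : IsBernoulliFamily p h) (hα : 3 / 4 < α) (j : Fin k) :
    ModelSpace p (k + 1) →L[ℂ] ModelSpace p k :=
  modelCollision (isSignFamily_signMul (ℓ := paramIndex j) hh rfl) hα (fun n => n.2 j)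
    (minusIndex_injective j)

theorem norm_modelPlus_le (hh : IsBernoulliFamily p h) (hα : 3 / 4 < α) (j : Fin k) :
    ‖modelPlus hh hα j‖ ≤ Real.sqrt (collisionConst α) :=
  norm_modelCollision_le _ _ _

theorem norm_modelMinus_le (hh : IsBernoulliFamily p h) (hα : 3 / 4 < α) (j : Fin k) :
    ‖modelMinus hh hα j‖ ≤ Real.sqrt (collisionConst α) :=
  norm_modelCollision_le _ _ _

/-- The series of the weighted terms of a collision operator, in `L²(Ω*)`. -/
theorem hasSum_coeffLp_modelCollision {S : Freq → Freq × Freq → TailL2 p (k + 1) →L[ℂ] TailL2 p k}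
    (hS : IsSignFamily S) (hα : 3 / 4 < α) (hα0 : 0 ≤ α) {η : FreqPair k → Freq}
    {m : FreqPair k → Freq × Freq → FreqPair (k + 1)}
    (hm : Function.Injective (Function.uncurry m))
    (hw : ∀ n q, weightRatio α (η n) q * sobolevWeight α (m n q).1 (m n q).2 =
      sobolevWeight α n.1 n.2) (v : ModelSpace p (k + 1)) (n : FreqPair k) :
    HasSum (fun q => ((sobolevWeight α (m n q).1 (m n q).2 : ℝ) : ℂ)⁻¹ •
      (S (η n) q (v (m n q)) : Lp ℂ 2 (starMeasure p)))
      (coeffLp n (synth hα0 (modelCollision hS hα η hm v))) := by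
  have h1 := ((hasSum_modelCollision hS hα hm v n (η := η)).mapL
    (Submodule.subtypeL (lpMeas ℂ ℂ (tailAlgebra Ω k) 2 (starMeasure p)))).const_smul
    ((sobolevWeight α n.1 n.2 : ℝ) : ℂ)⁻¹
  rw [coeffLp_synth]
  refine Eq.mp (congrArg (fun f => HasSum f _) (funext fun q => ?_)) h1
  have hpos : ((sobolevWeight α n.1 n.2 : ℝ) : ℂ) ≠ 0 :=
    Complex.ofReal_ne_zero.2 (sobolevWeight_pos _ _ _).ne'
  have hpos' : ((sobolevWeight α (m n q).1 (m n q).2 : ℝ) : ℂ) ≠ 0 :=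
    Complex.ofReal_ne_zero.2 (sobolevWeight_pos _ _ _).ne'
  have e : ((sobolevWeight α n.1 n.2 : ℝ) : ℂ)⁻¹ * (weightRatio α (η n) q : ℂ) =
      ((sobolevWeight α (m n q).1 (m n q).2 : ℝ) : ℂ)⁻¹ := by
    rw [inv_mul_eq_iff_eq_mul₀ hpos, eq_mul_inv_iff_mul_eq₀ hpos', ← hw n q]
    push_cast
    rfl
  rw [← e, mul_smul]
  rfl

/-- A term of a collision operator, as an element of `L²(Ω*)`. -/
def signTerm (hh : IsBernoulliFamily p h) {ℓ : {ℓ : ℕ // 2 ≤ ℓ}} (hℓ : ℓ.1 = k + 1) (α : ℝ)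
    (η : Freq) (m : Freq × Freq → FreqPair (k + 1)) (v : ModelSpace p (k + 1))
    (q : Freq × Freq) : Lp ℂ 2 (starMeasure p) :=
  ((sobolevWeight α (m q).1 (m q).2 : ℝ) : ℂ)⁻¹ •
    (signMul hh hℓ η q (v (m q)) : Lp ℂ 2 (starMeasure p))

theorem coeFn_signTerm (hh : IsBernoulliFamily p h) (hα0 : 0 ≤ α)
    {ℓ : {ℓ : ℕ // 2 ≤ ℓ}} (hℓ : ℓ.1 = k + 1) (η : Freq) (m : Freq × Freq → FreqPair (k + 1))
    (v : ModelSpace p (k + 1)) (q : Freq × Freq) :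
    signTerm hh hℓ α η m v q =ᵐ[starMeasure p] fun ω => ((signProd h η q (ω ℓ) : ℝ) : ℂ) *
        fourierCoeff (synth hα0 v ω) (m q).1 (m q).2 := by
  filter_upwards [Lp.coeFn_smul ((sobolevWeight α (m q).1 (m q).2 : ℝ) : ℂ)⁻¹
    (signMul hh hℓ η q (v (m q)) : Lp ℂ 2 (starMeasure p)),
    coeFn_signMulLp hh ℓ η q (v (m q) : Lp ℂ 2 (starMeasure p)),
    coeFn_fourierCoeff_synth hα0 v (m q)] with ω h1 h2 h3
  rw [signTerm, h1, Pi.smul_apply, coe_signMul, h2, h3, smul_eq_mul]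
  ring

theorem isCollisionPlus_iff (hh : IsBernoulliFamily p h) (hα0 : 0 ≤ α) (j : Fin k)
    (v : ModelSpace p (k + 1)) (τ : RandomDM p k) :
    IsCollisionPlus h j (synth hα0 v) τ ↔ ∀ n : FreqPair k, HasSum
      (signTerm hh (ℓ := paramIndex j) rfl α (n.1 j) (plusIndex j n) v) (coeffLp n τ) :=
  hasCollisionSum_iff (fun n q => coeFn_signTerm hh hα0 rfl (n.1 j) (plusIndex j n) v q) τ

theorem isCollisionMinus_iff (hh : IsBernoulliFamily p h) (hα0 : 0 ≤ α) (j : Fin k)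
    (v : ModelSpace p (k + 1)) (τ : RandomDM p k) :
    IsCollisionMinus h j (synth hα0 v) τ ↔ ∀ n : FreqPair k, HasSum
      (signTerm hh (ℓ := paramIndex j) rfl α (n.2 j) (minusIndex j n) v) (coeffLp n τ) := by
  -- Exchanging $a$ and $b$ gives the minus series the same sign pattern as the plus series; an
  -- unconditional sum is insensitive to this.
  have hG : ∀ (n : FreqPair k) (q : Freq × Freq),
      signTerm hh (ℓ := paramIndex j) rfl α (n.2 j) (minusIndex j n) v q.swap =ᵐ[starMeasure p]
        collisionTermMinus h j (synth hα0 v) n.1 n.2 q.1 q.2 := fun n q => by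
    filter_upwards [coeFn_signTerm hh hα0 (ℓ := paramIndex j) rfl (n.2 j) (minusIndex j n) v
      q.swap] with ω hω
    rw [hω, collisionTermMinus, signProd]
    simp only [minusIndex, Prod.fst_swap, Prod.snd_swap]
    push_cast
    ring
  refine (hasCollisionSum_iff hG τ).trans (forall_congr' fun n => ?_)
  exact (Equiv.prodComm Freq Freq).hasSum_iff
    (f := signTerm hh (ℓ := paramIndex j) rfl α (n.2 j) (minusIndex j n) v)

theorem isCollisionPlus_synth (hh : IsBernoulliFamily p h) (hα : 3 / 4 < α) (hα0 : 0 ≤ α)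
    (j : Fin k) (v : ModelSpace p (k + 1)) :
    IsCollisionPlus h j (synth hα0 v) (synth hα0 (modelPlus hh hα j v)) :=
  (isCollisionPlus_iff hh hα0 j v _).2 fun n => hasSum_coeffLp_modelCollision _ hα hα0 _
    (weightRatio_mul_sobolevWeight_plusIndex j α) v n

theorem isCollisionMinus_synth (hh : IsBernoulliFamily p h) (hα : 3 / 4 < α) (hα0 : 0 ≤ α)
    (j : Fin k) (v : ModelSpace p (k + 1)) :
    IsCollisionMinus h j (synth hα0 v) (synth hα0 (modelMinus hh hα j v)) :=
  (isCollisionMinus_iff hh hα0 j v _).2 fun n => hasSum_coeffLp_modelCollision _ hα hα0 _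
    (weightRatio_mul_sobolevWeight_minusIndex j α) v n

theorem inCollisionDomain_synth (hh : IsBernoulliFamily p h) (hα : 3 / 4 < α) (hα0 : 0 ≤ α)
    (v : ModelSpace p (k + 1)) : InCollisionDomain h k (synth hα0 v) := fun j =>
  ⟨⟨_, isCollisionPlus_synth hh hα hα0 j v⟩, ⟨_, isCollisionMinus_synth hh hα hα0 j v⟩⟩

/-- The operator is defined by choice, but a sum in $L^2(\Omega^*)$ is unique and the coefficients
determine the density matrix. -/
theorem collisionPlus_synth (hh : IsBernoulliFamily p h) (hα : 3 / 4 < α) (hα0 : 0 ≤ α)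
    (j : Fin k) (v : ModelSpace p (k + 1)) :
    collisionPlus h j (synth hα0 v) = synth hα0 (modelPlus hh hα j v) := by
  have H : ∃ τ, IsCollisionPlus h j (synth hα0 v) τ := ⟨_, isCollisionPlus_synth hh hα hα0 j v⟩
  rw [collisionPlus, dif_pos H]
  exact ext_coeffLp fun n => ((isCollisionPlus_iff hh hα0 j v _).1 H.choose_spec n).unique
    ((isCollisionPlus_iff hh hα0 j v _).1 (isCollisionPlus_synth hh hα hα0 j v) n)

theorem collisionMinus_synth (hh : IsBernoulliFamily p h) (hα : 3 / 4 < α) (hα0 : 0 ≤ α)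
    (j : Fin k) (v : ModelSpace p (k + 1)) :
    collisionMinus h j (synth hα0 v) = synth hα0 (modelMinus hh hα j v) := by
  have H : ∃ τ, IsCollisionMinus h j (synth hα0 v) τ := ⟨_, isCollisionMinus_synth hh hα hα0 j v⟩
  rw [collisionMinus, dif_pos H]
  exact ext_coeffLp fun n => ((isCollisionMinus_iff hh hα0 j v _).1 H.choose_spec n).unique
    ((isCollisionMinus_iff hh hα0 j v _).1 (isCollisionMinus_synth hh hα hα0 j v) n)

/-- The full randomized collision operator on the model space. -/
def modelFullCollision (hh : IsBernoulliFamily p h) (hα : 3 / 4 < α) (k : ℕ) :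
    ModelSpace p (k + 1) →L[ℂ] ModelSpace p k :=
  ∑ j : Fin k, (modelPlus hh hα j - modelMinus hh hα j)

theorem collision_synth (hh : IsBernoulliFamily p h) (hα : 3 / 4 < α) (hα0 : 0 ≤ α)
    (v : ModelSpace p (k + 1)) :
    collision h k (synth hα0 v) = synth hα0 (modelFullCollision hh hα k v) := by
  simp only [collision, modelFullCollision, collisionPlus_synth hh hα, collisionMinus_synth hh hα,
    sum_apply, map_sum, sub_apply, map_sub]

theorem norm_modelFullCollision_le (hh : IsBernoulliFamily p h) (hα : 3 / 4 < α) (k : ℕ)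
    (v : ModelSpace p (k + 1)) :
    ‖modelFullCollision hh hα k v‖ ≤ k * (2 * Real.sqrt (collisionConst α)) * ‖v‖ := by
  refine (modelFullCollision hh hα k).le_of_opNorm_le ?_ v
  have : ∀ j ∈ (Finset.univ : Finset (Fin k)), ‖modelPlus hh hα j - modelMinus hh hα j‖ ≤
      2 * Real.sqrt (collisionConst α) := fun j _ => by
    rw [two_mul]
    exact (norm_sub_le (modelPlus hh hα j) (modelMinus hh hα j)).trans
      (add_le_add (norm_modelPlus_le hh hα j) (norm_modelMinus_le hh hα j))
  refine (norm_sum_le_of_le _ this).trans ?_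
  simp

end Random

/-! ### Duhamel expansions of abstract hierarchies -/

/-- The data of a linear hierarchy in a sequence of Banach spaces: strongly continuous groups of
isometries, and collision operators whose norms grow at most linearly. -/
structure Hierarchy (M : ℕ → Type*) [∀ k, NormedAddCommGroup (M k)]
    [∀ k, NormedSpace ℂ (M k)] where
  /-- The free evolution. -/
  evol : ∀ k, ℝ → M k →L[ℂ] M k
  /-- The collision operators. -/
  coll : ∀ k, M (k + 1) →L[ℂ] M k
  /-- The constant in the bound of the collision operators. -/
  const : ℝ
  const_nonneg : 0 ≤ const
  norm_evol : ∀ k t v, ‖evol k t v‖ = ‖v‖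
  evol_add : ∀ k s t v, evol k (s + t) v = evol k s (evol k t v)
  continuous_evol : ∀ k, Continuous fun x : ℝ × M k => evol k x.1 x.2
  norm_coll_le : ∀ k v, ‖coll k v‖ ≤ k * const * ‖v‖

namespace Hierarchy

variable {M : ℕ → Type*} [∀ k, NormedAddCommGroup (M k)] [∀ k, NormedSpace ℂ (M k)]
  (H : Hierarchy M)

/-- The integrand of the Duhamel formula. -/
def integrand (k : ℕ) (t s : ℝ) (v : M (k + 1)) : M k := H.evol k (t - s) (H.coll k v)

/-- The iterated Duhamel integrals, without the factor `(-i)^j`. -/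
def duhamel (g : ∀ k, M k) : (j k : ℕ) → ℝ → M k
  | 0, k, t => H.evol k t (g k)
  | j + 1, k, t => ∫ s in (0 : ℝ)..t, H.integrand k t s (duhamel g j (k + 1) s)

variable (g : ∀ k, M k)

theorem continuousOn_integrand {k : ℕ} {f : ℝ → M (k + 1)} {s : Set ℝ}
    (hf : ContinuousOn f s) (t : ℝ) : ContinuousOn (fun r => H.integrand k t r (f r)) s :=
  (H.continuous_evol k).comp_continuousOn ((continuousOn_const.sub continuousOn_id).prodMk
    ((H.coll k).continuous.comp_continuousOn hf))

theorem continuous_integrand {k : ℕ} {f : ℝ → M (k + 1)} (hf : Continuous f) (t : ℝ) :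
    Continuous fun r => H.integrand k t r (f r) := by
  rw [← continuousOn_univ]
  exact H.continuousOn_integrand hf.continuousOn t

theorem norm_integrand_le (k : ℕ) (t s : ℝ) (v : M (k + 1)) :
    ‖H.integrand k t s v‖ ≤ k * H.const * ‖v‖ := by
  rw [integrand, norm_evol]
  exact H.norm_coll_le k v

section Complete

variable [∀ k, CompleteSpace (M k)]

theorem continuous_duhamel (j k : ℕ) : Continuous (H.duhamel g j k) := by
  induction j generalizing k with
  | zero =>
    exact (H.continuous_evol k).comp (continuous_id.prodMk continuous_const)
  | succ j ih =>
    have hf : Continuous fun s : ℝ => H.integrand k 0 s (H.duhamel g j (k + 1) s) :=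
      H.continuous_integrand (ih (k + 1)) 0
    -- The time `t` occurs both in the integrand and as an endpoint. The group law pulls the
    -- evolution by `t` out of the integral and leaves a primitive.
    have e : H.duhamel g (j + 1) k = fun t => H.evol k t (∫ s in (0 : ℝ)..t,
        H.integrand k 0 s (H.duhamel g j (k + 1) s)) := by
      funext t
      rw [duhamel, ← ContinuousLinearMap.intervalIntegral_comp_comm _
        (hf.intervalIntegrable _ _)]
      refine intervalIntegral.integral_congr fun s _ => ?_
      simp only [integrand]
      rw [← H.evol_add, zero_sub, sub_eq_add_neg]
    rw [e]
    exact (H.continuous_evol k).comp (continuous_id.prodMk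
      (intervalIntegral.continuous_primitive (fun a b => hf.intervalIntegrable a b) 0))

omit [∀ k, CompleteSpace (M k)] in
-- The collisions give $(k+1)\cdots(k+j)$ and the time simplex $1/j!$; together they form the
-- binomial coefficient.
theorem norm_duhamel_le (j k : ℕ) {t : ℝ} (ht : 0 ≤ t) :
    ‖H.duhamel g j (k + 1) t‖ ≤
      (k + j).choose j * (H.const * t) ^ j * ‖g (k + j + 1)‖ := by
  have hc0 := H.const_nonneg
  set c : ℝ := H.const with hc
  -- As a real function of the order, `G` allows index arithmetic without transport between
  -- different spaces `M n`.
  set G : ℕ → ℝ := fun n => ‖g n‖ with hG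
  change _ ≤ _ * G (k + j + 1)
  induction j generalizing k t with
  | zero =>
    simp only [duhamel, norm_evol, pow_zero, Nat.choose_zero_right, Nat.cast_one,
      one_mul, add_zero]
    exact le_rfl
  | succ j ih =>
    have hbound : ∀ s ∈ Set.Ioc (0 : ℝ) t,
        ‖H.integrand (k + 1) t s (H.duhamel g j (k + 1 + 1) s)‖ ≤
          ((k + 1 : ℕ) * c * ((k + 1 + j).choose j * c ^ j * G (k + 1 + j + 1))) * s ^ j := by
      intro s hs
      refine (H.norm_integrand_le _ _ _ _).trans ?_
      rw [mul_assoc ((k + 1 : ℕ) * c), ← hc]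
      refine mul_le_mul_of_nonneg_left ((ih (k + 1) hs.1.le).trans (le_of_eq ?_)) (by positivity)
      rw [mul_pow]
      ring
    have hint : IntervalIntegrable (fun s : ℝ =>
        ((k + 1 : ℕ) * c * ((k + 1 + j).choose j * c ^ j * G (k + 1 + j + 1))) * s ^ j)
        volume 0 t := Continuous.intervalIntegrable (by fun_prop) _ _
    rw [duhamel]
    refine (intervalIntegral.norm_integral_le_of_norm_le ht
      (Eventually.of_forall hbound) hint).trans ?_
    rw [intervalIntegral.integral_const_mul, integral_pow]
    -- Integrating $s^j$ yields $1/(j+1)$, the collision yields $k+1$: this is the recursion of the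
    -- binomial coefficients.
    have hch := Nat.choose_succ_right_eq (k + 1 + j) j
    rw [show k + 1 + j - j = k + 1 by omega] at hch
    have hch' : ((k + 1 + j).choose (j + 1) : ℝ) * (j + 1) =
        (k + 1 + j).choose j * (k + 1) := by exact_mod_cast hch
    rw [show k + (j + 1) = k + 1 + j by ring]
    have hj : (j : ℝ) + 1 ≠ 0 := by positivity
    refine le_of_eq ?_
    rw [zero_pow (Nat.succ_ne_zero j), sub_zero, mul_div_assoc', div_eq_iff hj, mul_pow]
    push_cast
    linear_combination (-(c ^ j * c * t ^ (j + 1) * G (k + 1 + j + 1))) * hch'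

/-- The solution of the hierarchy. -/
def solution (k : ℕ) (t : ℝ) : M k := ∑' j : ℕ, (-Complex.I) ^ j • H.duhamel g j k t

variable {T r : ℝ}

omit [∀ k, CompleteSpace (M k)] in
-- Of $\binom{k+j}{j}\le 2^k2^j$, the factor $2^j$ is absorbed by the smallness of `T`, while $2^k$
-- is left for the ratio $\xi/\xi'$.
theorem norm_smul_duhamel_le (hT : 2 * H.const * T ≤ r) (j k : ℕ) {t : ℝ}
    (ht : t ∈ Set.Icc 0 T) :
    ‖(-Complex.I) ^ j • H.duhamel g j (k + 1) t‖ ≤ 2 ^ k * (r ^ j * ‖g (k + j + 1)‖) := by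
  rw [norm_smul, norm_pow, norm_neg, Complex.norm_I, one_pow, one_mul]
  refine (H.norm_duhamel_le g j k ht.1).trans ?_
  rw [← mul_assoc]
  refine mul_le_mul_of_nonneg_right ?_ (norm_nonneg _)
  have h1 : ((k + j).choose j : ℝ) ≤ 2 ^ k * 2 ^ j := by
    rw [← pow_add]
    exact_mod_cast Nat.choose_le_two_pow (k + j) j
  have h2 : 2 * (H.const * t) ≤ r := by
    refine le_trans ?_ hT
    nlinarith [H.const_nonneg, ht.2]
  have h0 : 0 ≤ H.const * t := mul_nonneg H.const_nonneg ht.1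
  calc _ ≤ 2 ^ k * 2 ^ j * (H.const * t) ^ j := mul_le_mul_of_nonneg_right h1 (by positivity)
    _ = 2 ^ k * (2 * (H.const * t)) ^ j := by rw [mul_pow 2, mul_assoc]
    _ ≤ 2 ^ k * r ^ j := by gcongr

variable (hr : 0 < r) (hsum : Summable fun n : ℕ => r ^ (n + 1) * ‖g (n + 1)‖)
include hr hsum

omit [∀ k, NormedSpace ℂ (M k)] [∀ k, CompleteSpace (M k)] in
theorem summable_duhamel_bound (k : ℕ) :
    Summable fun j : ℕ => (2 : ℝ) ^ k * (r ^ j * ‖g (k + j + 1)‖) := by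
  have h1 := (((summable_nat_add_iff k).2 hsum).mul_left (r ^ (k + 1))⁻¹).mul_left ((2 : ℝ) ^ k)
  refine h1.congr fun j => ?_
  have e : r ^ (j + k + 1) = r ^ (k + 1) * r ^ j := by ring
  rw [e, mul_assoc (r ^ (k + 1)), inv_mul_cancel_left₀ (by positivity), add_comm j k]

variable (hT : 2 * H.const * T ≤ r)
include hT

theorem hasSum_solution (k : ℕ) {t : ℝ} (ht : t ∈ Set.Icc 0 T) :
    HasSum (fun j : ℕ => (-Complex.I) ^ j • H.duhamel g j (k + 1) t) (H.solution g (k + 1) t) :=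
  (Summable.of_norm_bounded (summable_duhamel_bound g hr hsum k) fun j =>
    H.norm_smul_duhamel_le g hT j k ht).hasSum

theorem continuousOn_solution (k : ℕ) :
    ContinuousOn (H.solution g (k + 1)) (Set.Icc 0 T) :=
  continuousOn_tsum (fun j => ((H.continuous_duhamel g j (k + 1)).const_smul
    ((-Complex.I) ^ j)).continuousOn) (summable_duhamel_bound g hr hsum k) fun j _ ht =>
    H.norm_smul_duhamel_le g hT j k ht

theorem intervalIntegrable_integrand (k : ℕ) {t : ℝ} (ht : t ∈ Set.Icc 0 T) :
    IntervalIntegrable (fun s => H.integrand (k + 1) t s (H.solution g (k + 1 + 1) s))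
      volume 0 t := by
  refine ContinuousOn.intervalIntegrable (H.continuousOn_integrand
    ((H.continuousOn_solution g hr hsum hT (k + 1)).mono ?_) t)
  rw [Set.uIcc_of_le ht.1]
  exact Set.Icc_subset_Icc_right ht.2

/-- Dominated convergence for series, with a majorant `b` that does not depend on `s`. -/
theorem hasSum_integral_solution (k : ℕ) {t : ℝ} (ht : t ∈ Set.Icc 0 T) :
    HasSum (fun j : ℕ => (-Complex.I) ^ j • H.duhamel g (j + 1) (k + 1) t)
      (∫ s in (0 : ℝ)..t, H.integrand (k + 1) t s (H.solution g (k + 1 + 1) s)) := by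
  set L : ℝ → M (k + 1 + 1) →L[ℂ] M (k + 1) := fun s =>
    (H.evol (k + 1) (t - s)).comp (H.coll (k + 1)) with hL
  have e : ∀ j : ℕ, (-Complex.I) ^ j • H.duhamel g (j + 1) (k + 1) t =
      ∫ s in (0 : ℝ)..t, L s ((-Complex.I) ^ j • H.duhamel g j (k + 1 + 1) s) := by
    intro j
    rw [duhamel, ← intervalIntegral.integral_smul]
    refine intervalIntegral.integral_congr fun s _ => ?_
    simp only [hL, map_smul]
    rfl
  simp only [e]
  have hmem : ∀ s ∈ Set.uIoc 0 t, s ∈ Set.Icc 0 T := fun s hs => by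
    rw [Set.uIoc_of_le ht.1] at hs
    exact ⟨hs.1.le, hs.2.trans ht.2⟩
  set b : ℕ → ℝ := fun j => (k + 1 : ℕ) * H.const *
    (2 ^ (k + 1) * (r ^ j * ‖g (k + 1 + j + 1)‖)) with hb
  have hbs : Summable b := (summable_duhamel_bound g hr hsum (k + 1)).mul_left _
  refine intervalIntegral.hasSum_integral_of_dominated_convergence (fun j _ => b j)
    (fun j => ?_) (fun j => ?_) ?_ ?_ ?_
  · exact (H.continuous_integrand ((H.continuous_duhamel g j
      (k + 1 + 1)).const_smul ((-Complex.I) ^ j)) t).aestronglyMeasurable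
  · refine Eventually.of_forall fun s hs => ?_
    exact (H.norm_integrand_le (k + 1) t s _).trans (mul_le_mul_of_nonneg_left
      (H.norm_smul_duhamel_le g hT j (k + 1) (hmem s hs))
      (mul_nonneg (Nat.cast_nonneg _) H.const_nonneg))
  · exact Eventually.of_forall fun _ _ => hbs
  · exact intervalIntegrable_const
  · exact Eventually.of_forall fun s hs =>
      (L s).hasSum (H.hasSum_solution g hr hsum hT (k + 1) (hmem s hs))

/-- Removing the free term from the series leaves $-i$ times the series of integrated terms. -/
theorem solution_eq (k : ℕ) {t : ℝ} (ht : t ∈ Set.Icc 0 T) :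
    H.solution g (k + 1) t - H.evol (k + 1) t (g (k + 1)) +
      Complex.I • ∫ s in (0 : ℝ)..t,
        H.integrand (k + 1) t s (H.solution g (k + 1 + 1) s) = 0 := by
  have h1 := H.hasSum_solution g hr hsum hT k ht
  have h2 := (H.hasSum_integral_solution g hr hsum hT k ht).const_smul (-Complex.I)
  simp only [smul_smul, ← pow_succ'] at h2
  have h3 := (hasSum_nat_add_iff' 1).2 h1
  have h4 := h3.unique h2
  simp only [Finset.range_one, Finset.sum_singleton, pow_zero, one_smul] at h4
  rw [duhamel] at h4
  rw [h4, neg_smul, neg_add_cancel]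

end Complete

end Hierarchy

/-! ### Comparison with the randomized hierarchy -/

section Random

variable {Ω : Type u} [MeasurableSpace Ω] {p : Measure Ω} [IsProbabilityMeasure p]
  {h : Freq → Ω → ℝ} {M : ℕ → Type*} [∀ k, NormedAddCommGroup (M k)]
  [∀ k, NormedSpace ℂ (M k)] [∀ k, CompleteSpace (M k)]

/-- `J` intertwines the abstract hierarchy `H` and the randomized hierarchy. -/
structure Intertwines (h : Freq → Ω → ℝ) (H : Hierarchy M)
    (J : ∀ k, M k →L[ℂ] RandomDM p k) : Prop where
  freeEvolutionR : ∀ k t v, freeEvolutionR k t (J k v) = J k (H.evol k t v)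
  inCollisionDomain : ∀ k v, InCollisionDomain h k (J (k + 1) v)
  collision : ∀ k v, collision h k (J (k + 1) v) = J k (H.coll k v)

variable {H : Hierarchy M} {J : ∀ k, M k →L[ℂ] RandomDM p k} (hJ : Intertwines h H J)
  {g : ∀ k, M k} {Γ₀ : ∀ k, DensityMatrix k}
  (hg : ∀ k, 1 ≤ k → J k (g k) = constRandom p (Γ₀ k))
include hJ

omit [IsProbabilityMeasure p] [∀ k, CompleteSpace (M k)] in
theorem Intertwines.integrand (k : ℕ) (t s : ℝ) (v : M (k + 1)) :
    GPHierarchy.freeEvolutionR k (t - s) (GPHierarchy.collision h k (J (k + 1) v)) =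
      J k (H.integrand k t s v) := by
  rw [hJ.collision, hJ.freeEvolutionR, Hierarchy.integrand]

include hg

/-- Integrals stand outside the accumulated operator `Φ`, which need not be continuous. Only its
values on the range of `J` matter; there it is given by the bounded operator `L`, which commutes
with Bochner integrals. Arbitrary `Φ` makes the induction close. -/
theorem Intertwines.nestedDuhamel {m : ℕ} (j : ℕ) {k : ℕ}
    (hk : 1 ≤ k) (t : ℝ) (Φ : RandomDM p k → RandomDM p m) (L : M k →L[ℂ] RandomDM p m)
    (hΦ : ∀ v, Φ (J k v) = L v) :
    GPHierarchy.nestedDuhamel h Γ₀ j k t Φ = L (H.duhamel g j k t) := by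
  induction j generalizing k t with
  | zero => rw [GPHierarchy.nestedDuhamel, ← hg k hk, hJ.freeEvolutionR, hΦ, Hierarchy.duhamel]
  | succ j ih =>
    rw [GPHierarchy.nestedDuhamel, Hierarchy.duhamel, ← L.intervalIntegral_comp_comm]
    · refine intervalIntegral.integral_congr fun s _ => ?_
      exact ih (Nat.le_succ_of_le hk) s _
        (L.comp ((H.evol k (t - s)).comp (H.coll k))) fun v => by
          rw [hJ.collision, hJ.freeEvolutionR, hΦ]
          rfl
    · exact (H.continuous_integrand
        (H.continuous_duhamel g j (k + 1)) t).intervalIntegrable _ _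

theorem Intertwines.duhamelTerm (j : ℕ) {k : ℕ} (hk : 1 ≤ k) (t : ℝ) :
    GPHierarchy.duhamelTerm h Γ₀ j k t = J k ((-Complex.I) ^ j • H.duhamel g j k t) := by
  rw [GPHierarchy.duhamelTerm, hJ.nestedDuhamel hg j hk t id (J k) fun _ => rfl, map_smul]

theorem Intertwines.truncatedSolution (N : ℕ) {k : ℕ} (hk : 1 ≤ k) (t : ℝ) :
    GPHierarchy.truncatedSolution h Γ₀ N k t =
      J k (∑ j ∈ Finset.range (N + 1 - k), (-Complex.I) ^ j • H.duhamel g j k t) := by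
  rw [GPHierarchy.truncatedSolution, map_sum]
  exact Finset.sum_congr rfl fun j _ => hJ.duhamelTerm hg j hk t

variable {T r : ℝ} (hr : 0 < r) (hsum : Summable fun n : ℕ => r ^ (n + 1) * ‖g (n + 1)‖)
  (hT : 2 * H.const * T ≤ r)
include hr hsum hT

omit hg [IsProbabilityMeasure p] in
theorem Intertwines.duhamelWellDefined :
    DuhamelWellDefined h T fun k t => J k (H.solution g k t) := by
  refine ⟨Eventually.of_forall fun s k _ => hJ.inCollisionDomain k _, fun t ht k hk => ?_⟩
  obtain ⟨k, rfl⟩ := Nat.exists_eq_add_of_le' hk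
  simp only [hJ.integrand]
  have := H.intervalIntegrable_integrand g hr hsum hT k ht
  exact ⟨(J (k + 1)).integrable_comp this.1, (J (k + 1)).integrable_comp this.2⟩

theorem Intertwines.duhamelDefect_eq_zero (k : ℕ) {t : ℝ} (ht : t ∈ Set.Icc 0 T) :
    duhamelDefect h Γ₀ (fun k t => J k (H.solution g k t)) (k + 1) t = 0 := by
  rw [duhamelDefect, ← hg (k + 1) (Nat.le_add_left 1 k), hJ.freeEvolutionR]
  simp only [hJ.integrand]
  rw [(J (k + 1)).intervalIntegral_comp_comm (H.intervalIntegrable_integrand g hr hsum hT k ht),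
    ← map_sub, ← map_smul, ← map_add, H.solution_eq g hr hsum hT k ht, map_zero]

end Random

/-! ### Convergence of the truncated solutions -/

namespace Hierarchy

variable {M : ℕ → Type*} [∀ k, NormedAddCommGroup (M k)] [∀ k, NormedSpace ℂ (M k)]
  [∀ k, CompleteSpace (M k)] (H : Hierarchy M) (g : ∀ k, M k) {T ξ ξ' : ℝ}

/-- With $n=k+j$, the remainder involves only data of order $n+1$ with $n\ge N$, and trading
$\xi^{k+1}$ for $\xi'^{k+1}$ leaves the factor $(2\xi/\xi')^k$. -/
theorem enorm_solution_sub_le (hξ' : 0 < ξ')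
    (hsum : Summable fun n : ℕ => ξ' ^ (n + 1) * ‖g (n + 1)‖) (hT : 2 * H.const * T ≤ ξ')
    (hξξ' : ξ < ξ') (N k : ℕ) {t : ℝ} (ht : t ∈ Set.Icc 0 T) :
    ENNReal.ofReal ξ ^ (k + 1) * ‖∑ j ∈ Finset.range (N + 1 - (k + 1)),
        (-Complex.I) ^ j • H.duhamel g j (k + 1) t - H.solution g (k + 1) t‖ₑ ≤
      (2 * ENNReal.ofReal ξ / ENNReal.ofReal ξ') ^ k *
        ∑' n, ENNReal.ofReal ξ' ^ (n + N + 1) * ‖g (n + N + 1)‖ₑ := by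
  set x := ENNReal.ofReal ξ with hx
  set x' := ENNReal.ofReal ξ' with hx'
  set a : ℕ → ℝ≥0∞ := fun n => x' ^ (n + 1) * ‖g (n + 1)‖ₑ with ha
  have hx'0 : x' ≠ 0 := (ENNReal.ofReal_pos.2 hξ').ne'
  have hx't : x' ≠ ∞ := ENNReal.ofReal_ne_top
  have hxx' : x ≤ x' := ENNReal.ofReal_le_ofReal hξξ'.le
  -- Truncated subtraction: for $k\ge N$ the partial sum is empty, and $k+m\ge N$ always.
  set m := N + 1 - (k + 1) with hm
  set f : ℕ → M (k + 1) := fun j => (-Complex.I) ^ j • H.duhamel g j (k + 1) t with hf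
  have hfs : Summable f := (H.hasSum_solution g hξ' hsum hT k ht).summable
  have hfle : ∀ j, x ^ (k + 1) * ‖f j‖ₑ ≤ (2 * x / x') ^ k * a (k + j) := fun j => by
    have h1 : ‖f j‖ₑ ≤ 2 ^ k * (x' ^ j * ‖g (k + j + 1)‖ₑ) := by
      have := ENNReal.ofReal_le_ofReal (H.norm_smul_duhamel_le g hT j k ht)
      rw [ENNReal.ofReal_mul (by positivity), ENNReal.ofReal_mul (by positivity),
        ENNReal.ofReal_pow (by positivity), ENNReal.ofReal_pow hξ'.le, ofReal_norm, ofReal_norm,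
        ENNReal.ofReal_ofNat] at this
      exact this
    have h2 : (2 * x) ^ k = (2 * x / x') ^ k * x' ^ k := by
      rw [← mul_pow, ENNReal.div_mul_cancel hx'0 hx't]
    calc x ^ (k + 1) * ‖f j‖ₑ ≤ x ^ (k + 1) * (2 ^ k * (x' ^ j * ‖g (k + j + 1)‖ₑ)) := by gcongr
      _ = (2 * x) ^ k * x * (x' ^ j * ‖g (k + j + 1)‖ₑ) := by ring
      _ ≤ (2 * x) ^ k * x' * (x' ^ j * ‖g (k + j + 1)‖ₑ) := by gcongr
      _ = (2 * x / x') ^ k * a (k + j) := by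
        rw [h2, ha]
        ring
  have e : ∑ j ∈ Finset.range m, f j - H.solution g (k + 1) t = -∑' j, f (j + m) := by
    rw [solution, ← hfs.sum_add_tsum_nat_add m]
    abel
  rw [e, enorm_neg]
  calc x ^ (k + 1) * ‖∑' j, f (j + m)‖ₑ ≤ x ^ (k + 1) * ∑' j, ‖f (j + m)‖ₑ := by
        gcongr
        exact enorm_tsum_le_tsum_enorm
    _ = ∑' j, x ^ (k + 1) * ‖f (j + m)‖ₑ := ENNReal.tsum_mul_left.symm
    _ ≤ ∑' j, (2 * x / x') ^ k * a (k + (j + m)) := ENNReal.tsum_le_tsum fun j => hfle (j + m)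
    _ = (2 * x / x') ^ k * ∑' j, a (k + (j + m)) := ENNReal.tsum_mul_left
    _ ≤ (2 * x / x') ^ k * ∑' n, a (n + N) := by
        refine mul_le_mul' le_rfl ?_
        have hinj : Function.Injective fun j : ℕ => k + (j + m) - N := fun i j hij => by
          simp only at hij
          omega
        have := ENNReal.tsum_comp_le_tsum_of_injective hinj fun n => a (n + N)
        refine le_trans (le_of_eq (tsum_congr fun j => ?_)) this
        congr 1
        omega

end Hierarchy

section Random

variable {Ω : Type u} [MeasurableSpace Ω] {p : Measure Ω} [IsProbabilityMeasure p]
  {h : Freq → Ω → ℝ} {α : ℝ}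

/-- The randomized hierarchy on the model space. -/
def modelHierarchy (hh : IsBernoulliFamily p h) (hα : 3 / 4 < α) :
    Hierarchy fun k => ModelSpace p k where
  evol _ := modelEvolution
  coll := modelFullCollision hh hα
  const := 2 * Real.sqrt (collisionConst α)
  const_nonneg := by positivity
  norm_evol _ := norm_modelEvolution
  evol_add _ := modelEvolution_add
  continuous_evol _ := continuous_modelEvolution_uncurry
  norm_coll_le := norm_modelFullCollision_le hh hα

theorem intertwines_synth (hh : IsBernoulliFamily p h) (hα : 3 / 4 < α) (hα0 : 0 ≤ α) :
    Intertwines h (modelHierarchy hh hα) fun k => synth (p := p) (k := k) hα0 where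
  freeEvolutionR _ := freeEvolutionR_synth hα0
  inCollisionDomain _ := inCollisionDomain_synth hh hα hα0
  collision _ := collision_synth hh hα hα0

theorem randomSobolevNorm_zero (hα0 : 0 ≤ α) (k : ℕ) :
    randomSobolevNorm α (0 : RandomDM p k) = 0 := by
  rw [← map_zero (synth hα0), randomSobolevNorm_synth, enorm_zero]

theorem timeRandomHNorm_le {T ξ : ℝ} {Γ : ∀ k, ℝ → RandomDM p k} {c : ℝ≥0∞}
    (hΓ : ∀ t ∈ Set.Icc 0 T, randomHNorm α ξ (fun k => Γ k t) ≤ c) :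
    timeRandomHNorm T α ξ Γ ≤ c :=
  essSup_le_of_ae_le c ((ae_restrict_iff' measurableSet_Icc).2 (Eventually.of_forall hΓ))

theorem exists_synth_eq_of_hNorm_lt_top (p : Measure Ω) [IsProbabilityMeasure p] (hα0 : 0 ≤ α)
    {ξ' : ℝ} (hξ' : 0 < ξ') {Γ₀ : ∀ k, DensityMatrix k} (hΓ₀ : hNorm α ξ' Γ₀ < ∞) :
    ∃ g : ∀ k, ModelSpace p k,
      (∀ k, 1 ≤ k → synth hα0 (g k) = constRandom p (Γ₀ k)) ∧
      (∑' n, ENNReal.ofReal ξ' ^ (n + 1) * ‖g (n + 1)‖ₑ = hNorm α ξ' Γ₀) ∧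
      Summable fun n : ℕ => ξ' ^ (n + 1) * ‖g (n + 1)‖ := by
  have hx : ENNReal.ofReal ξ' ≠ 0 := (ENNReal.ofReal_pos.2 hξ').ne'
  have hfin : ∀ k, sobolevNorm α (Γ₀ (k + 1)) < ∞ := fun k => by
    have h1 := (ENNReal.le_tsum k).trans_lt hΓ₀
    rw [ENNReal.mul_lt_top_iff] at h1
    rcases h1 with h1 | h1 | h1
    · exact h1.2
    · exact absurd h1 (pow_ne_zero _ hx)
    · simp [h1]
  have hex : ∀ k, ∃ v : ModelSpace p k, 1 ≤ k → synth hα0 v = constRandom p (Γ₀ k) ∧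
      ‖v‖ₑ = sobolevNorm α (Γ₀ k) := fun k => by
    rcases Nat.eq_zero_or_pos k with rfl | hk
    -- Order zero enters no norm; its value is arbitrary.
    · exact ⟨0, fun h => absurd h (by norm_num)⟩
    · obtain ⟨k, rfl⟩ := Nat.exists_eq_add_of_le' hk
      obtain ⟨v, hv⟩ := exists_synth_eq_constRandom (p := p) hα0 (hfin k)
      exact ⟨v, fun _ => hv⟩
  choose g hg using hex
  have hsum : ∑' n, ENNReal.ofReal ξ' ^ (n + 1) * ‖g (n + 1)‖ₑ = hNorm α ξ' Γ₀ :=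
    tsum_congr fun n => by rw [(hg (n + 1) (Nat.le_add_left 1 n)).2]
  refine ⟨g, fun k hk => (hg k hk).1, hsum, ?_⟩
  rw [← hsum] at hΓ₀
  refine (ENNReal.summable_toReal hΓ₀.ne).congr fun n => ?_
  rw [ENNReal.toReal_mul, ENNReal.toReal_pow, ENNReal.toReal_ofReal hξ'.le, toReal_enorm]

end Random

end GPHierarchy

end

/-! ### The main theorem -/

open GPHierarchy in
theorem theorem3p14 :
    ∃ C₂ : ℝ, 0 < C₂ ∧ ∀ α : ℝ, 3 / 4 < α → ∃ C₁ : ℝ, 0 < C₁ ∧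
      ∀ ξ ξ' : ℝ, 0 < ξ → ξ < ξ' → C₂ * ξ / ξ' < 1 → ∃ C : ℝ, 0 < C ∧
        ∀ T : ℝ, 0 < T → C₁ * T / ξ' < 1 →
        ∀ (Ω : Type*) [MeasurableSpace Ω] (p : MeasureTheory.Measure Ω)
          [MeasureTheory.IsProbabilityMeasure p] (h : GPHierarchy.Freq → Ω → ℝ),
          GPHierarchy.IsBernoulliFamily p h →
        ∀ Γ₀ : ∀ k, GPHierarchy.DensityMatrix k, GPHierarchy.hNorm α ξ' Γ₀ < ⊤ →
          ∃ Γ : ∀ k, ℝ → GPHierarchy.RandomDM p k,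
            GPHierarchy.MemTimeRandomH T α ξ Γ ∧
            Filter.Tendsto (fun N : ℕ => GPHierarchy.timeRandomHNorm T α ξ
                (fun k t => GPHierarchy.truncatedSolution h Γ₀ N k t - Γ k t))
              Filter.atTop (nhds 0) ∧
            GPHierarchy.DuhamelWellDefined h T Γ ∧
            (∀ ξ₀ : ℝ, 0 < ξ₀ →
              GPHierarchy.timeRandomHNorm T α ξ₀ (GPHierarchy.duhamelDefect h Γ₀ Γ) = 0) ∧
            (∀ᵐ t ∂(MeasureTheory.volume.restrict (Set.Icc (0 : ℝ) T)), ∀ k, 1 ≤ k →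
              GPHierarchy.randomSobolevNorm α (GPHierarchy.duhamelDefect h Γ₀ Γ k t) = 0) ∧
            GPHierarchy.timeRandomHNorm T α ξ Γ ≤
              ENNReal.ofReal C * GPHierarchy.hNorm α ξ' Γ₀ := by
  -- $C_2=2$ comes from the factor $2^k$ and $C_1=2c$ from the condition $2cT\le\xi'$, where
  -- $c=2\sqrt{\texttt{collisionConst}\,\alpha}$.
  refine ⟨2, two_pos, fun α hα => ⟨4 * Real.sqrt (collisionConst α),
    mul_pos (by norm_num) (Real.sqrt_pos.2 (collisionConst_pos α)), fun ξ ξ' hξ hξξ' hC₂ => ?_⟩⟩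
  have hα0 : 0 ≤ α := by linarith
  have hξ' : 0 < ξ' := hξ.trans hξξ'
  set ρ : ENNReal := 2 * ENNReal.ofReal ξ / ENNReal.ofReal ξ' with hρ
  have hρ1 : ρ < 1 := by
    have : ρ = ENNReal.ofReal (2 * ξ / ξ') := by
      rw [hρ, ENNReal.ofReal_div_of_pos hξ', ENNReal.ofReal_mul (by norm_num),
        ENNReal.ofReal_ofNat]
    rw [this]
    exact ENNReal.ofReal_lt_one.2 hC₂
  have hρtop : (1 - ρ)⁻¹ ≠ ⊤ := ENNReal.inv_ne_top.2 (tsub_pos_of_lt hρ1).ne'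
  have hρ0 : (1 - ρ)⁻¹ ≠ 0 :=
    ENNReal.inv_ne_zero.2 (ne_top_of_le_ne_top ENNReal.one_ne_top tsub_le_self)
  -- $C$ is the sum of the geometric series of ratio $2\xi/\xi'$.
  refine ⟨((1 - ρ)⁻¹).toReal, ENNReal.toReal_pos hρ0 hρtop, ?_⟩
  intro T _ hC₁ Ω _ p _ h hh Γ₀ hΓ₀
  rw [ENNReal.ofReal_toReal hρtop]
  obtain ⟨g, hg, hgsum, hsum⟩ := exists_synth_eq_of_hNorm_lt_top p hα0 hξ' hΓ₀
  set H := modelHierarchy hh hα with hH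
  have hJ : Intertwines h H fun k => synth (p := p) (k := k) hα0 := intertwines_synth hh hα hα0
  have hT : 2 * H.const * T ≤ ξ' := by
    rw [div_lt_one hξ'] at hC₁
    change 2 * (2 * Real.sqrt (collisionConst α)) * T ≤ ξ'
    linarith
  set a : ℕ → ENNReal := fun n => ENNReal.ofReal ξ' ^ (n + 1) * ‖g (n + 1)‖ₑ with ha
  have hbound : ∀ N, ∀ t ∈ Set.Icc 0 T, randomHNorm α ξ (fun k =>
      truncatedSolution h Γ₀ N k t - synth hα0 (H.solution g k t)) ≤
        (1 - ρ)⁻¹ * ∑' n, a (n + N) := fun N t ht => by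
    rw [randomHNorm, ← ENNReal.tsum_geometric, ← ENNReal.tsum_mul_right]
    refine ENNReal.tsum_le_tsum fun k => ?_
    rw [hJ.truncatedSolution hg N (Nat.le_add_left 1 k) t, ← map_sub, randomSobolevNorm_synth]
    exact H.enorm_solution_sub_le g hξ' hsum hT hξξ' N k ht
  have hmain : timeRandomHNorm T α ξ (fun k t => synth hα0 (H.solution g k t)) ≤
      (1 - ρ)⁻¹ * hNorm α ξ' Γ₀ := by
    refine timeRandomHNorm_le fun t ht => ?_
    rw [← hgsum, randomHNorm, ← ENNReal.tsum_geometric, ← ENNReal.tsum_mul_right]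
    refine ENNReal.tsum_le_tsum fun k => ?_
    rw [randomSobolevNorm_synth, ← enorm_neg]
    -- For $N=0$ the truncated solution vanishes in all orders $k\ge1$, so the remainder estimate
    -- bounds the solution itself.
    simpa using H.enorm_solution_sub_le g hξ' hsum hT hξξ' 0 k ht
  have hzero : ∀ t ∈ Set.Icc 0 T, ∀ k, 1 ≤ k → randomSobolevNorm α
      (duhamelDefect h Γ₀ (fun k t => synth hα0 (H.solution g k t)) k t) = 0 :=
    fun t ht k hk => by
    obtain ⟨k, rfl⟩ := Nat.exists_eq_add_of_le' hk
    rw [hJ.duhamelDefect_eq_zero hg hξ' hsum hT k ht, randomSobolevNorm_zero hα0]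
  refine ⟨fun k t => synth hα0 (H.solution g k t), ⟨fun k hk => ?_, ?_⟩, ?_, ?_, ?_, ?_, hmain⟩
  · obtain ⟨k, rfl⟩ := Nat.exists_eq_add_of_le' hk
    exact ((synth hα0).continuous.comp_continuousOn
      (H.continuousOn_solution g hξ' hsum hT k)).aestronglyMeasurable measurableSet_Icc
  · exact hmain.trans_lt (ENNReal.mul_lt_top hρtop.lt_top hΓ₀)
  · have hlim : Filter.Tendsto (fun N => (1 - ρ)⁻¹ * ∑' n, a (n + N)) Filter.atTop (nhds 0) := by
      have hfin : ∑' n, a n ≠ ⊤ := by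
        rw [hgsum]
        exact hΓ₀.ne
      have := ENNReal.Tendsto.const_mul (ENNReal.tendsto_sum_nat_add a hfin)
        (Or.inr hρtop)
      rwa [mul_zero] at this
    exact tendsto_of_tendsto_of_tendsto_of_le_of_le tendsto_const_nhds hlim (fun _ => zero_le)
      fun N => timeRandomHNorm_le (hbound N)
  · exact hJ.duhamelWellDefined hξ' hsum hT
  -- The defect vanishes for every `t` in the interval, so the weight `ξ₀` plays no role.
  · refine fun ξ₀ _ => le_antisymm (timeRandomHNorm_le fun t ht => ?_) (zero_le)
    rw [randomHNorm]
    refine le_of_eq (ENNReal.tsum_eq_zero.2 fun k => ?_)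
    rw [hzero t ht (k + 1) (Nat.le_add_left 1 k), mul_zero]
  · exact (ae_restrict_iff' measurableSet_Icc).2 (Eventually.of_forall hzero)
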